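/- Let $\Omega\subset\mathbb{R}^2$ be a nonempty bounded, convex domain (open set) with $C^1$-boundary, let $|\partial\Omega|$ be its perimeter, and suppose that $$0\le L-n|\partial\Omega|\le \operatorname{diam}(\Omega)\qquad\text{for some } n\in\{0,1,2,\dots\}.$$ For a (countably) 1-rectifiable, $\mathcal H^1$-measurable set $\mathcal{L}\subset\overline\Omega$ of finite length, with unit normal $\nu(x)$ (defined up to sign at $\mathcal H^1$-almost every $x \in \mathcal{L}$) and arclength measure $\sigma=\mathcal H^1|_{\mathcal{L}}$, let $$E(\mathcal{L})=\int_{\mathcal{L}}\int_{\mathcal{L}}k(x,y)\,d\sigma(x)\,d\sigma(y)\in[0,\infty],\qquad k(x,y)=\frac{|\langle \nu(x),y-x\rangle\langle y-x,\nu(y)\rangle|}{\|x-y\|^3}.$$ In order to count copies, consider also 1-rectifiable sets with multiplicities: $\mathcal H^1$-measurable functions $\theta:\mathbb{R}^2\to\{0,1,2,\dots\}$ with support contained in $\overline\Omega$ and 1-rectifiable. Their length is $\int\theta\,d\mathcal H^1$ and their energy is $$\widehat E(\theta)=\iint k(x,y)\,\theta(x)\theta(y)\,d\mathcal H^1(x)\,d\mathcal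 H^1(y)+2\int\theta(\theta-1)\,d\mathcal H^1,$$ with $\nu$ the unit normal of the support of $\theta$; the last term is the interaction of copies that lie on top of each other (the limit of the additional mutual energy of two parallel copies of an arc, as their distance tends to $0$, is twice the length of the arc). A set $\mathcal{L}$ is the case $\theta=1_{\mathcal{L}}$, and $\widehat E(1_{\mathcal{L}})=E(\mathcal{L})$. Then $\overline\Omega$ contains a line segment of length $L-n|\partial\Omega|$, and for every line segment $K\subset\overline\Omega$ of that length, the union of $n$ copies of $\partial\Omega$ and $K$, that is $\theta_0=n1_{\partial\Omega}+1_K$, has the following properties. 1. $\theta_0$ is a 1-rectifiable set with multiplicities in $\overline\Omega$, of length $L$. 2. $\widehat E(\theta_0)\le\widehat E(\theta)$ for every 1-rectifiable set with multiplicities $\theta$ in $\overline\Omega$ of length $L$; in particular $\widehat E(\theta_0)\le E(\mathcal{L})$ for every 1-rectifiable set $\mathcal{L}\subset\overline\Omega$ of length $L$. 3. $\widehat E(\theta_0)=\inf E(\mathcal{L})$, where the infimum is over all 1-rectifiable sets $\mathcal{L}\subset\overline\Omega$ of length $L$ (without multiplicities). -/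

import Mathlib

open MeasureTheory Set
open scoped ENNReal NNReal

noncomputable section

/-- The Euclidean plane. -/
abbrev Plane : Type := EuclideanSpace ℝ (Fin 2)

/-- `Ω` has `C¹` boundary: near each boundary point, `Ω` is the sublevel set of a `C¹` function
whose differential does not vanish. -/
def HasC1Boundary (Ω : Set Plane) : Prop :=
  ∀ p ∈ frontier Ω, ∃ U : Set Plane, IsOpen U ∧ p ∈ U ∧
    ∃ g : Plane → ℝ, ContDiffOn ℝ 1 g U ∧ (∀ x ∈ U, fderiv ℝ g x ≠ 0) ∧
      Ω ∩ U = {x ∈ U | g x < 0}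

/-- The perimeter `|∂Ω|`, the one-dimensional Hausdorff measure of the boundary. -/
def perimeter (Ω : Set Plane) : ℝ := (μH[1] (frontier Ω)).toReal

/-- Countable 1-rectifiability: up to a set of length zero, `A` is covered by countably many
Lipschitz curves. -/
def IsRectifiable (A : Set Plane) : Prop :=
  ∃ γ : ℕ → ℝ → Plane, (∀ i, ∃ C : ℝ≥0, LipschitzWith C (γ i)) ∧
    μH[1] (A \ ⋃ i, range (γ i)) = 0

/-- `ν` is a unit normal field of `A`: every Lipschitz curve has, at almost every time that it
spends in `A`, a velocity orthogonal to `ν`. On a rectifiable set such a field exists and is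
unique up to sign and up to a set of length zero. -/
def IsUnitNormalField (A : Set Plane) (ν : Plane → Plane) : Prop :=
  (∀ x, ‖ν x‖ = 1) ∧
    ∀ γ : ℝ → Plane, (∃ C : ℝ≥0, LipschitzWith C γ) →
      ∀ᵐ t : ℝ, γ t ∈ A → inner ℝ (ν (γ t)) (deriv γ t) = 0

open Classical in
/-- The unit normal `n(x)` of `A` (a choice among the fields that differ by signs and null sets,
none of which affects the energy). -/
def unitNormal (A : Set Plane) : Plane → Plane :=
  if h : ∃ ν, IsUnitNormalField A ν then h.choose else 0

/-- The integrand `|⟨n(x), y - x⟩ ⟨y - x, n(y)⟩| / ‖x - y‖³`. -/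
def energyKernel (ν : Plane → Plane) (x y : Plane) : ℝ :=
  |inner ℝ (ν x) (y - x) * inner ℝ (y - x) (ν y)| / ‖x - y‖ ^ 3

/-- The energy `E(A)` of a set, the double integral over `A × A` with respect to arclength. -/
def energy (A : Set Plane) : ℝ≥0∞ :=
  ∫⁻ x in A, ∫⁻ y in A, ENNReal.ofReal (energyKernel (unitNormal A) x y) ∂μH[1] ∂μH[1]

/-- `A` is a one-dimensional rectifiable set of length `L` in the closure of `Ω`. -/
structure IsRectifiableSetIn (Ω : Set Plane) (L : ℝ) (A : Set Plane) : Prop where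
  subset : A ⊆ closure Ω
  measurable : NullMeasurableSet A μH[1]
  rectifiable : IsRectifiable A
  length_eq : μH[1] A = ENNReal.ofReal L

/-- Arclength counted with multiplicity `θ`. -/
def arclength (θ : Plane → ℕ) : Measure Plane :=
  μH[1].withDensity fun x => (θ x : ℝ≥0∞)

/-- `θ` is the multiplicity function of a one-dimensional rectifiable set with multiplicities,
contained in the closure of `Ω`, whose length counted with multiplicity is `L`. -/
structure IsRectifiableMultisetIn (Ω : Set Plane) (L : ℝ) (θ : Plane → ℕ) : Prop where
  subset : Function.support θ ⊆ closure Ω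
  measurable : AEMeasurable θ μH[1]
  rectifiable : IsRectifiable (Function.support θ)
  length_eq : arclength θ univ = ENNReal.ofReal L

/-- The energy of a set with multiplicities. The first term is the double integral over pairs of
points at distinct places. The second one is the mutual energy of copies lying on top of each
other, `2` per unit length for each of the `θ (θ - 1)` ordered pairs of distinct copies: two
parallel copies of an arc of length `s` at distance `δ → 0` have mutual energy tending to the
energy of the arc plus `2 s` (for `δ > 0`, `∫ δ² / (t² + δ²)^(3/2) dt = 2`), whereas the double
integral alone would not see this interaction when `δ = 0`. -/
def multisetEnergy (θ : Plane → ℕ) : ℝ≥0∞ :=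
  (∫⁻ x, ∫⁻ y, ENNReal.ofReal (energyKernel (unitNormal (Function.support θ)) x y)
      ∂arclength θ ∂arclength θ)
    + 2 * ∫⁻ x, ((θ x - 1 : ℕ) : ℝ≥0∞) ∂arclength θ

/-- The multiplicity function of a set (each point counted once). -/
def setMultiplicity (A : Set Plane) : Plane → ℕ := A.indicator 1

/-- The multiplicity function of the union of `n` copies of `∂Ω` and the segment `[a, b]`. -/
def boundaryCopiesAndSegment (Ω : Set Plane) (n : ℕ) (a b : Plane) : Plane → ℕ :=
  n • setMultiplicity (frontier Ω) + setMultiplicity (segment ℝ a b)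

lemma arclength_setMultiplicity {A : Set Plane} (hA : NullMeasurableSet A μH[1]) :
    arclength (setMultiplicity A) = μH[1].restrict A := by
  obtain ⟨B, -, hB, hBA⟩ := hA.exists_measurable_superset_ae_eq
  rw [← Measure.restrict_congr_set hBA, ← withDensity_indicator_one hB]
  refine withDensity_congr_ae ?_
  filter_upwards [hBA] with x hx
  have hx' : x ∈ B ↔ x ∈ A := iff_of_eq hx
  by_cases h : x ∈ A <;> simp [setMultiplicity, hx', h]

/-- On sets without multiplicity, the energy with multiplicities is the energy. -/
lemma multisetEnergy_setMultiplicity {A : Set Plane} (hA : NullMeasurableSet A μH[1]) :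
    multisetEnergy (setMultiplicity A) = energy A := by
  have hs : Function.support (setMultiplicity A) = A := by
    ext x; simp [setMultiplicity]
  have h0 : ∀ x, setMultiplicity A x - 1 = 0 := by
    intro x; by_cases h : x ∈ A <;> simp [setMultiplicity, h]
  simp [multisetEnergy, energy, hs, h0, arclength_setMultiplicity hA]

end

/-!
Let `N` be the number of points, counted with multiplicity, on a line, and integrate over all lines
with respect to the measure that is invariant under rigid motions. By Crofton's formula `∫ N` is
twice the length. A pair of points at distinct places determines a line, and `energyKernel` is the
Jacobian of this change of variables, so that `∫ N²` is the energy with multiplicities plus twice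
the length.

Since `N` is an integer or infinite, `(N - 2 n) (N - 2 n - 1) ≥ 0`. Integrated over the lines that
meet `Ω`, this bounds the energy from below by the length of the multiset and the perimeter of `Ω`,
because almost every line that meets `Ω` meets `∂Ω` exactly twice. For `n` copies of `∂Ω` and a
segment, `N` is `2 n` or `2 n + 1` on almost every such line, and equality holds.

To approach this minimum without multiplicity, replace the `n` copies of `∂Ω` by homothetic ones
with distinct factors slightly less than `1`, which almost every line meets at most as often, and
restore the length by a short segment, which few lines meet.
-/

open scoped Function

noncomputable section

/-! ### Partitions adapted to a differentiable map -/

section Partition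

variable {E F : Type*} [NormedAddCommGroup E] [NormedSpace ℝ E] [NormedAddCommGroup F]
  [NormedSpace ℝ F] {f : E → F}

lemma antilipschitzWith_domRestrict_of_approximatesLinearOn {A : E →L[ℝ] F} {s : Set E}
    {K c : ℝ≥0} (hA : AntilipschitzWith K A) (h : ApproximatesLinearOn f A s c) (hc : c < K⁻¹) :
    AntilipschitzWith (K⁻¹ - c)⁻¹ (s.domRestrict f) := by
  have hsum : s.domRestrict f = fun x : s => s.domRestrict A x + (f x - A x) := by
    ext x
    simp only [domRestrict_apply, add_sub_cancel]
  rw [hsum]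
  exact (hA.domRestrict s).add_lipschitzWith h.lipschitz_sub hc

variable [FiniteDimensional ℝ E] [SecondCountableTopology F] [MeasurableSpace E] [BorelSpace E]

lemma exists_measurable_partition_approximatesLinearOn {T : Set E} (hT : MeasurableSet T)
    (hd : ∀ x ∈ T, DifferentiableAt ℝ f x) {r : (E →L[ℝ] F) → ℝ≥0} (hr : ∀ A, r A ≠ 0) :
    ∃ (P : ℕ → Set E) (A : ℕ → E →L[ℝ] F), Pairwise (Disjoint on P) ∧
      (∀ n, MeasurableSet (P n)) ∧ ⋃ n, P n = T ∧
      (∀ n, ApproximatesLinearOn f (A n) (P n) (r (A n))) ∧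
      (T.Nonempty → ∀ n, ∃ y ∈ T, A n = fderiv ℝ f y) := by
  obtain ⟨t, A, ht, htm, hTt, happ, hA⟩ :=
    exists_partition_approximatesLinearOn_of_hasFDerivWithinAt f T (fderiv ℝ f)
      (fun x hx => (hd x hx).hasFDerivAt.hasFDerivWithinAt) r hr
  refine ⟨fun n => T ∩ t n, A, fun i j hij => (ht hij).mono inter_subset_right inter_subset_right,
    fun n => hT.inter (htm n), ?_, happ, hA⟩
  rw [← inter_iUnion, inter_eq_left.2 hTt]

lemma exists_measurable_partition_antilipschitzWith {T : Set E} (hT : MeasurableSet T)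
    (hd : ∀ x ∈ T, DifferentiableAt ℝ f x) (hinj : ∀ x ∈ T, Function.Injective (fderiv ℝ f x)) :
    ∃ P : ℕ → Set E, Pairwise (Disjoint on P) ∧ (∀ n, MeasurableSet (P n)) ∧ ⋃ n, P n = T ∧
      ∀ n, ∃ K, AntilipschitzWith K ((P n).domRestrict f) := by
  rcases T.eq_empty_or_nonempty with rfl | hne
  · exact ⟨fun _ => ∅, fun _ _ _ => disjoint_empty _, fun _ => .empty, iUnion_empty,
      fun _ => ⟨1, .of_subsingleton⟩⟩
  have hex : ∀ A : E →L[ℝ] F, ∃ r : ℝ≥0, r ≠ 0 ∧ (Function.Injective A →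
      ∀ s, ApproximatesLinearOn f A s r → ∃ K, AntilipschitzWith K (s.domRestrict f)) := by
    intro A
    by_cases hA : Function.Injective A
    · obtain ⟨K, hK, hAK⟩ :=
        (A : E →ₗ[ℝ] F).exists_antilipschitzWith (LinearMap.ker_eq_bot.2 hA)
      exact ⟨K⁻¹ / 2, by positivity, fun _ s hs =>
        ⟨_, antilipschitzWith_domRestrict_of_approximatesLinearOn hAK hs
          (NNReal.half_lt_self (by positivity))⟩⟩
    · exact ⟨1, one_ne_zero, fun h => (hA h).elim⟩
  choose r hr hrA using hex
  obtain ⟨P, A, hP, hPm, hPT, happ, hA⟩ :=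
    exists_measurable_partition_approximatesLinearOn hT hd hr
  refine ⟨P, hP, hPm, hPT, fun n => ?_⟩
  obtain ⟨y, hy, hAy⟩ := hA hne n
  exact hrA (A n) (hAy ▸ hinj y hy) (P n) (happ n)

end Partition

/-! ### Sums over fibres and the area formula with multiplicities -/

section FiberSum

variable {α β : Type*} {h : α → β}

/-- The sum of `g` over the points of `T` that `h` maps to `y`: the multiplicity function of the
area formula. -/
def fiberSum (h : α → β) (T : Set α) (g : α → ℝ≥0∞) (y : β) : ℝ≥0∞ :=
  ∑' x, (T ∩ h ⁻¹' {y}).indicator g x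

lemma fiberSum_eq_zero {T : Set α} {y : β} (hy : y ∉ h '' T) (g : α → ℝ≥0∞) :
    fiberSum h T g y = 0 := by
  refine ENNReal.tsum_eq_zero.2 fun x => indicator_of_notMem ?_ _
  rintro ⟨hx, rfl⟩
  exact hy ⟨x, hx, rfl⟩

lemma fiberSum_apply_of_injOn {T : Set α} (hi : InjOn h T) (g : α → ℝ≥0∞) {x : α} (hx : x ∈ T) :
    fiberSum h T g (h x) = g x := by
  rw [fiberSum, tsum_eq_single x fun z hz => indicator_of_notMem
    (fun hz' => hz (hi hz'.1 hx hz'.2)) g]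
  exact indicator_of_mem (show x ∈ T ∩ h ⁻¹' {h x} from ⟨hx, rfl⟩) g

lemma fiberSum_union {S T : Set α} (hST : Disjoint S T) (g : α → ℝ≥0∞) (y : β) :
    fiberSum h (S ∪ T) g y = fiberSum h S g y + fiberSum h T g y := by
  simp only [fiberSum]
  rw [← ENNReal.tsum_add]
  refine tsum_congr fun x => ?_
  rw [union_inter_distrib_right, indicator_union_of_disjoint]
  exact hST.mono inter_subset_left inter_subset_left

lemma fiberSum_iUnion {T : ℕ → Set α} (hT : Pairwise (Disjoint on T)) (g : α → ℝ≥0∞) (y : β) :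
    fiberSum h (⋃ i, T i) g y = ∑' i, fiberSum h (T i) g y := by
  simp only [fiberSum]
  rw [ENNReal.tsum_comm]
  refine tsum_congr fun x => ?_
  by_cases hx : ∃ i, x ∈ T i ∩ h ⁻¹' {y}
  · obtain ⟨i, hi⟩ := hx
    rw [tsum_eq_single i fun j hj => indicator_of_notMem
        (fun H => (hT hj).le_bot ⟨H.1, hi.1⟩) g,
      indicator_of_mem hi, iUnion_inter, indicator_of_mem (mem_iUnion_of_mem i hi)]
  · rw [iUnion_inter, indicator_of_notMem fun H => hx (mem_iUnion.1 H), eq_comm]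
    exact ENNReal.tsum_eq_zero.2 fun i => indicator_of_notMem (fun H => hx ⟨i, H⟩) _

lemma fiberSum_comp_mul (T : Set α) (g : α → ℝ≥0∞) (G : β → ℝ≥0∞) (y : β) :
    fiberSum h T (fun x => G (h x) * g x) y = G y * fiberSum h T g y := by
  rw [fiberSum, fiberSum, ← ENNReal.tsum_mul_left]
  refine tsum_congr fun x => ?_
  by_cases hx : x ∈ T ∩ h ⁻¹' {y}
  · rw [indicator_of_mem hx, indicator_of_mem hx, show h x = y from hx.2]
  · rw [indicator_of_notMem hx, indicator_of_notMem hx, mul_zero]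

end FiberSum

section AreaFormula

variable {E : Type*} [NormedAddCommGroup E] [NormedSpace ℝ E] [FiniteDimensional ℝ E]
  [MeasurableSpace E] [BorelSpace E] {h : E → E} {T : Set E} {g : E → ℝ≥0∞}

lemma measurable_fiberSum_of_injOn (hT : MeasurableSet T)
    (hd : ∀ x ∈ T, DifferentiableAt ℝ h x) (hi : InjOn h T) (hg : Measurable g) :
    Measurable (fiberSum h T g) := by
  have hm := measurableEmbedding_of_fderivWithin hT
    (fun x hx => (hd x hx).hasFDerivAt.hasFDerivWithinAt) hi
  have hext : fiberSum h T g = Function.extend (T.domRestrict h) (fun x => g x) 0 := by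
    funext y
    by_cases hy : y ∈ h '' T
    · obtain ⟨x, hx, rfl⟩ := hy
      rw [fiberSum_apply_of_injOn hi g hx]
      exact (hm.injective.extend_apply (fun x : T => g x) 0 ⟨x, hx⟩).symm
    · rw [fiberSum_eq_zero hy, Function.extend_apply', Pi.zero_apply]
      rintro ⟨⟨x, hx⟩, rfl⟩
      exact hy ⟨x, hx, rfl⟩
  rw [hext]
  exact hm.measurable_extend (hg.comp measurable_subtype_coe) measurable_const

lemma measurable_det_fderiv (h : E → E) : Measurable fun x => (fderiv ℝ h x).det :=
  ContinuousLinearMap.continuous_det.measurable.comp (measurable_fderiv ℝ h)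

variable (μ : Measure E) [μ.IsAddHaarMeasure]

lemma lintegral_fiberSum_of_injOn (hT : MeasurableSet T)
    (hd : ∀ x ∈ T, DifferentiableAt ℝ h x) (hi : InjOn h T) (g : E → ℝ≥0∞) :
    ∫⁻ y, fiberSum h T g y ∂μ = ∫⁻ x in T, ENNReal.ofReal |(fderiv ℝ h x).det| * g x ∂μ := by
  have hd' : ∀ x ∈ T, HasFDerivWithinAt h (fderiv ℝ h x) T x := fun x hx =>
    (hd x hx).hasFDerivAt.hasFDerivWithinAt
  have hsupp : Function.support (fiberSum h T g) ⊆ h '' T := fun y hy => by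
    by_contra hy'
    exact hy (fiberSum_eq_zero hy' g)
  rw [← setLIntegral_eq_of_support_subset hsupp,
    lintegral_image_eq_lintegral_abs_det_fderiv_mul μ hT hd' hi]
  refine setLIntegral_congr_fun hT fun x hx => ?_
  simp only [fiberSum_apply_of_injOn hi g hx]

/-- Critical points contribute nothing because their image is null (Sard). -/
lemma exists_injOn_pieces_fiberSum_ae_eq (hT : MeasurableSet T)
    (hd : ∀ x ∈ T, DifferentiableAt ℝ h x) (g : E → ℝ≥0∞) :
    ∃ P : ℕ → Set E, Pairwise (Disjoint on P) ∧ (∀ n, MeasurableSet (P n)) ∧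
      ⋃ n, P n = T \ {x | (fderiv ℝ h x).det = 0} ∧ (∀ n, InjOn h (P n)) ∧
      fiberSum h T g =ᵐ[μ] fun y => ∑' n, fiberSum h (P n) g y := by
  set D : Set E := {x | (fderiv ℝ h x).det = 0}
  have hDm : MeasurableSet D := measurable_det_fderiv h (measurableSet_singleton 0)
  obtain ⟨P, hP, hPm, hPU, hPK⟩ := exists_measurable_partition_antilipschitzWith (f := h)
    (hT.diff hDm) (fun x hx => hd x hx.1)
    fun x hx => ((fderiv ℝ h x).toContinuousLinearEquivOfDetNeZero hx.2).injective
  have hnull : μ (h '' (T ∩ D)) = 0 :=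
    addHaar_image_eq_zero_of_det_fderivWithin_eq_zero μ
      (fun x hx => (hd x hx.1).hasFDerivAt.hasFDerivWithinAt) (fun x hx => hx.2)
  refine ⟨P, hP, hPm, hPU, fun n => ?_, ?_⟩
  · obtain ⟨K, hK⟩ := hPK n
    exact injOn_iff_injective.2 hK.injective
  · filter_upwards [measure_eq_zero_iff_ae_notMem.1 hnull] with y hy
    rw [← fiberSum_iUnion hP, hPU, ← zero_add (fiberSum h (T \ D) g y),
      ← fiberSum_eq_zero hy g, ← fiberSum_union, inter_union_sdiff]
    exact disjoint_sdiff_right.mono_left inter_subset_right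

lemma aemeasurable_fiberSum (hT : MeasurableSet T) (hd : ∀ x ∈ T, DifferentiableAt ℝ h x)
    (hg : Measurable g) : AEMeasurable (fiberSum h T g) μ := by
  obtain ⟨P, -, hPm, hPU, hPi, hae⟩ := exists_injOn_pieces_fiberSum_ae_eq μ hT hd g
  have hPT : ∀ n, P n ⊆ T := fun n => (subset_iUnion P n).trans (hPU.trans_subset sdiff_subset)
  exact ⟨_, Measurable.tsum fun n => measurable_fiberSum_of_injOn (hPm n)
    (fun x hx => hd x (hPT n hx)) (hPi n) hg, hae⟩

theorem lintegral_fiberSum (hT : MeasurableSet T) (hd : ∀ x ∈ T, DifferentiableAt ℝ h x)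
    (hg : Measurable g) :
    ∫⁻ y, fiberSum h T g y ∂μ = ∫⁻ x in T, ENNReal.ofReal |(fderiv ℝ h x).det| * g x ∂μ := by
  obtain ⟨P, hP, hPm, hPU, hPi, hae⟩ := exists_injOn_pieces_fiberSum_ae_eq μ hT hd g
  have hPd : ∀ n, ∀ x ∈ P n, DifferentiableAt ℝ h x := fun n x hx =>
    hd x ((hPU ▸ mem_iUnion_of_mem n hx : x ∈ T \ _).1)
  have hDm : MeasurableSet {x | (fderiv ℝ h x).det = 0} :=
    measurable_det_fderiv h (measurableSet_singleton 0)
  rw [lintegral_congr_ae hae, lintegral_tsum fun n =>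
    (measurable_fiberSum_of_injOn (hPm n) (hPd n) (hPi n) hg).aemeasurable]
  simp_rw [fun n => lintegral_fiberSum_of_injOn μ (hPm n) (hPd n) (hPi n) g]
  rw [← lintegral_iUnion hPm hP, hPU, ← lintegral_inter_add_sdiff _ T hDm,
    setLIntegral_congr_fun (g := fun _ => 0) (hT.inter hDm), lintegral_zero, zero_add]
  intro x hx
  simp [show (fderiv ℝ h x).det = 0 from hx.2]

lemma ae_det_fderiv_eq_zero_or_of_ae (hm : Measurable h) (hT : MeasurableSet T)
    (hd : ∀ x ∈ T, DifferentiableAt ℝ h x) {p : E → Prop} (hp : ∀ᵐ y ∂μ, p y) :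
    ∀ᵐ x ∂μ.restrict T, (fderiv ℝ h x).det = 0 ∨ p (h x) := by
  set Z := toMeasurable μ {y | ¬ p y}
  have hZ : Measurable (Z.indicator (1 : E → ℝ≥0∞)) :=
    measurable_one.indicator (measurableSet_toMeasurable _ _)
  have hZ0 : μ Z = 0 := by rw [measure_toMeasurable]; exact ae_iff.1 hp
  have hZh : Measurable fun x => Z.indicator (1 : E → ℝ≥0∞) (h x) * 1 :=
    (hZ.comp hm).mul_const 1
  have hfiber : ∫⁻ y, fiberSum h T (fun x => Z.indicator 1 (h x) * 1) y ∂μ = 0 := by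
    rw [← lintegral_zero (μ := μ)]
    refine lintegral_congr_ae ?_
    filter_upwards [measure_eq_zero_iff_ae_notMem.1 hZ0] with y hy
    rw [fiberSum_comp_mul, indicator_of_notMem hy, zero_mul]
  rw [lintegral_fiberSum μ hT hd hZh] at hfiber
  filter_upwards [(lintegral_eq_zero_iff
    ((measurable_det_fderiv h).abs.ennreal_ofReal.mul hZh)).1 hfiber] with x hx
  by_contra! hdet
  have hxZ : h x ∈ Z := subset_toMeasurable _ _ hdet.2
  simp [hxZ, hdet.1] at hx

end AreaFormula

/-! ### Length of curves -/

lemma ae_accPt_of_mem (S : Set ℝ) : ∀ᵐ x : ℝ, x ∈ S → AccPt x (Filter.principal S) := by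
  have h := (countable_setOfPred_isolated_right_within (s := S)).measure_zero volume
  filter_upwards [measure_eq_zero_iff_ae_notMem.1 h] with x hx hxS
  rw [accPt_principal_iff_nhdsWithin]
  have hright : (nhdsWithin x (S ∩ Ioi x)).NeBot := by
    rw [Filter.neBot_iff]
    exact fun H => hx ⟨hxS, H⟩
  exact hright.mono (nhdsWithin_mono _ fun y hy => ⟨hy.1, (ne_of_gt hy.2 : y ≠ x)⟩)

lemma exists_measurable_partition_measure_ne_top {α : Type*} [MeasurableSpace α]
    (μ : Measure α) [SigmaFinite μ] {T : Set α} (hT : MeasurableSet T) :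
    ∃ P : ℕ → Set α, Pairwise (Disjoint on P) ∧ (∀ n, MeasurableSet (P n)) ∧ ⋃ n, P n = T ∧
      ∀ n, μ (P n) ≠ ∞ := by
  refine ⟨fun n => T ∩ disjointed (spanningSets μ) n, fun i j hij =>
    (disjoint_disjointed _ hij).mono inter_subset_right inter_subset_right,
    fun n => hT.inter (MeasurableSet.disjointed (measurableSet_spanningSets μ) n), ?_, fun n => ?_⟩
  · rw [← inter_iUnion, iUnion_disjointed, iUnion_spanningSets, inter_univ]
  · exact ((measure_mono (inter_subset_right.trans (disjointed_subset _ n))).trans_lt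
      (measure_spanningSets_lt_top μ n)).ne

lemma le_of_forall_le_add_mul {a b v : ℝ≥0∞} (hv : v ≠ ∞)
    (h : ∀ ε : ℝ≥0, ε ≠ 0 → a ≤ b + (ε + ε : ℝ≥0) * v) : a ≤ b := by
  have hlim : Filter.Tendsto (fun ε : ℝ≥0 => b + (ε + ε : ℝ≥0) * v) (nhdsWithin 0 {0}ᶜ)
      (nhds b) := by
    have h0 : Filter.Tendsto (fun ε : ℝ≥0 => ((ε + ε : ℝ≥0) : ℝ≥0∞)) (nhdsWithin 0 {0}ᶜ)
        (nhds 0) :=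
      ((ENNReal.continuous_coe.comp (continuous_id.add continuous_id)).tendsto' 0 0
        (by simp)).mono_left nhdsWithin_le_nhds
    simpa only [zero_mul, add_zero] using
      tendsto_const_nhds.add (ENNReal.Tendsto.mul_const h0 (Or.inr hv))
  exact ge_of_tendsto hlim (eventually_mem_nhdsWithin.mono h)

lemma measure_image_iUnion_of_injOn {α β : Type*} [TopologicalSpace α] [PolishSpace α]
    [MeasurableSpace α] [BorelSpace α] [TopologicalSpace β] [T2Space β] [MeasurableSpace β]
    [OpensMeasurableSpace β] (μ : Measure β) {f : α → β} {P : ℕ → Set α}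
    (hP : Pairwise (Disjoint on P)) (hPm : ∀ n, MeasurableSet (P n))
    (hf : ContinuousOn f (⋃ n, P n)) (hi : InjOn f (⋃ n, P n)) :
    μ (f '' ⋃ n, P n) = ∑' n, μ (f '' P n) := by
  rw [image_iUnion, measure_iUnion _ fun n => (hPm n).image_of_continuousOn_injOn
    (hf.mono (subset_iUnion P n)) (hi.mono (subset_iUnion P n))]
  intro i j hij
  change Disjoint (f '' P i) (f '' P j)
  rw [disjoint_iff_inter_eq_empty, ← hi.image_inter (subset_iUnion P i) (subset_iUnion P j),
    (hP hij).inter_eq, image_empty]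

lemma hausdorffMeasure_le_of_antilipschitzWith_domRestrict {X Y : Type*} [EMetricSpace X]
    [EMetricSpace Y] [MeasurableSpace X] [BorelSpace X] [MeasurableSpace Y] [BorelSpace Y]
    {f : X → Y} {s : Set X} {K : ℝ≥0} (hf : AntilipschitzWith K (s.domRestrict f)) {d : ℝ}
    (hd : 0 ≤ d) : μH[d] s ≤ (K : ℝ≥0∞) ^ d * μH[d] (f '' s) := by
  have himage := hf.le_hausdorffMeasure_image hd univ
  rwa [← isometry_subtype_coe.hausdorffMeasure_image (Or.inl hd), image_univ, image_univ,
    Subtype.range_coe, range_domRestrict] at himage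

section CurveLength

variable {F : Type*} [NormedAddCommGroup F] [NormedSpace ℝ F] {f : ℝ → F}

lemma ae_norm_deriv_sub_norm_le_of_approximatesLinearOn {A : ℝ →L[ℝ] F} {P : Set ℝ} {ε : ℝ≥0}
    (h : ApproximatesLinearOn f A P ε) (hd : ∀ x ∈ P, DifferentiableAt ℝ f x) :
    ∀ᵐ x : ℝ, x ∈ P → ‖deriv f x‖ₑ ≤ ‖A 1‖ₑ + ε ∧ ‖A 1‖ₑ ≤ ‖deriv f x‖ₑ + ε := by
  filter_upwards [ae_accPt_of_mem P] with x hx hxP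
  have hacc := hx hxP
  rw [accPt_principal_iff_nhdsWithin] at hacc
  have hderiv : HasDerivWithinAt (fun y => f y - A y) (deriv f x - A 1) P x :=
    ((hd x hxP).hasDerivAt.sub A.hasDerivAt).hasDerivWithinAt
  have hle : ‖deriv f x - A 1‖ ≤ ε := by
    rw [hasDerivWithinAt_iff_tendsto_slope] at hderiv
    refine le_of_tendsto hderiv.norm ?_
    filter_upwards [self_mem_nhdsWithin] with y hy
    have hyx : 0 < ‖y - x‖ := norm_pos_iff.2 (sub_ne_zero.2 hy.2)
    rw [slope_def_module, norm_smul, norm_inv, inv_mul_le_iff₀ hyx, mul_comm,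
      sub_sub_sub_comm, ← A.map_sub]
    exact h y hy.1 x hxP
  have hleₑ : ‖deriv f x - A 1‖ₑ ≤ ε := by
    rw [enorm_le_coe]
    exact hle
  constructor
  · calc ‖deriv f x‖ₑ = ‖A 1 + (deriv f x - A 1)‖ₑ := by rw [add_sub_cancel]
      _ ≤ ‖A 1‖ₑ + ε := (enorm_add_le _ _).trans (by gcongr)
  · calc ‖A 1‖ₑ = ‖deriv f x - (deriv f x - A 1)‖ₑ := by rw [sub_sub_cancel]
      _ ≤ ‖deriv f x‖ₑ + ε := enorm_sub_le.trans (by gcongr)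

lemma nnnorm_eq_nnnorm_apply_one (A : ℝ →L[ℝ] F) : ‖A‖₊ = ‖A 1‖₊ := by
  have h := norm_deriv_eq_norm_fderiv (𝕜 := ℝ) (f := A) (x := 0)
  rw [A.fderiv, A.deriv] at h
  exact NNReal.eq h.symm

variable [MeasurableSpace F] [BorelSpace F]

lemma hausdorffMeasure_image_le_of_approximatesLinearOn {A : ℝ →L[ℝ] F} {P : Set ℝ} {ε : ℝ≥0}
    (h : ApproximatesLinearOn f A P ε) :
    μH[1] (f '' P) ≤ (‖A 1‖ₑ + ε) * volume P := by
  have hl : LipschitzOnWith (‖A‖₊ + ε) f P := lipschitzOnWith_iff_restrict.2 h.lipschitz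
  simpa only [hausdorffMeasure_real, ENNReal.rpow_one, ENNReal.coe_add, enorm_eq_nnnorm,
    nnnorm_eq_nnnorm_apply_one] using hl.hausdorffMeasure_image_le (d := 1) zero_le_one

lemma le_hausdorffMeasure_image_of_approximatesLinearOn {A : ℝ →L[ℝ] F} {P : Set ℝ} {ε : ℝ≥0}
    (h : ApproximatesLinearOn f A P ε) :
    ‖A 1‖ₑ * volume P ≤ μH[1] (f '' P) + ε * volume P := by
  rcases le_or_gt ‖A 1‖₊ ε with hA | hA
  · exact le_add_left (mul_le_mul_left (ENNReal.coe_le_coe.2 hA) _)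
  have hAnti : AntilipschitzWith ‖A 1‖₊⁻¹ A := by
    refine A.antilipschitz_of_bound fun t => ?_
    have hAt : A t = t • A 1 := by rw [← A.map_smul, smul_eq_mul, mul_one]
    rw [hAt, norm_smul, NNReal.coe_inv, coe_nnnorm, mul_left_comm,
      inv_mul_cancel₀ (show ‖A 1‖ ≠ 0 from ne_of_gt (ε.2.trans_lt hA)), mul_one]
  have hAntif := antilipschitzWith_domRestrict_of_approximatesLinearOn hAnti h (by rwa [inv_inv])
  have himage := hausdorffMeasure_le_of_antilipschitzWith_domRestrict hAntif zero_le_one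
  rw [hausdorffMeasure_real, ENNReal.rpow_one, inv_inv, ENNReal.coe_inv (tsub_pos_of_lt hA).ne',
    ← ENNReal.div_eq_inv_mul, ENNReal.le_div_iff_mul_le (Or.inl (ENNReal.coe_ne_zero.2
      (tsub_pos_of_lt hA).ne')) (Or.inl ENNReal.coe_ne_top)] at himage
  calc ‖A 1‖ₑ * volume P = (↑(‖A 1‖₊ - ε) + ↑ε) * volume P := by
        rw [← ENNReal.coe_add, tsub_add_cancel_of_le hA.le, enorm_eq_nnnorm]
    _ = volume P * ↑(‖A 1‖₊ - ε) + ε * volume P := by rw [add_mul, mul_comm (volume P)]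
    _ ≤ μH[1] (f '' P) + ε * volume P := by gcongr

variable [SecondCountableTopology F]

lemma hausdorffMeasure_image_le_lintegral_add {T : Set ℝ} (hT : MeasurableSet T)
    (hd : ∀ x ∈ T, DifferentiableAt ℝ f x) {ε : ℝ≥0} (hε : ε ≠ 0) :
    μH[1] (f '' T) ≤ (∫⁻ t in T, ‖deriv f t‖ₑ) + (ε + ε : ℝ≥0) * volume T := by
  obtain ⟨P, A, hP, hPm, rfl, happ, -⟩ :=
    exists_measurable_partition_approximatesLinearOn hT hd fun _ => hε
  have hpiece : ∀ n, μH[1] (f '' P n) ≤ ∫⁻ t in P n, (‖deriv f t‖ₑ + (ε + ε : ℝ≥0)) := by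
    intro n
    refine (hausdorffMeasure_image_le_of_approximatesLinearOn (happ n)).trans ?_
    rw [← setLIntegral_const]
    refine setLIntegral_mono_ae' (hPm n) ?_
    filter_upwards [ae_norm_deriv_sub_norm_le_of_approximatesLinearOn (happ n)
      fun x hx => hd x (mem_iUnion_of_mem n hx)] with x hx hxP
    rw [ENNReal.coe_add, ← add_assoc]
    gcongr
    exact (hx hxP).2
  calc μH[1] (f '' ⋃ n, P n) ≤ ∑' n, μH[1] (f '' P n) := by
        rw [image_iUnion]
        exact measure_iUnion_le _
    _ ≤ ∑' n, ∫⁻ t in P n, (‖deriv f t‖ₑ + (ε + ε : ℝ≥0)) := ENNReal.tsum_le_tsum hpiece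
    _ = _ := by
        rw [← lintegral_iUnion hPm hP, lintegral_add_right _ measurable_const, setLIntegral_const]

lemma lintegral_le_hausdorffMeasure_image_add {T : Set ℝ} (hT : MeasurableSet T)
    (hd : ∀ x ∈ T, DifferentiableAt ℝ f x) (hi : InjOn f T) {ε : ℝ≥0} (hε : ε ≠ 0) :
    (∫⁻ t in T, ‖deriv f t‖ₑ) ≤ μH[1] (f '' T) + (ε + ε : ℝ≥0) * volume T := by
  obtain ⟨P, A, hP, hPm, rfl, happ, -⟩ :=
    exists_measurable_partition_approximatesLinearOn hT hd fun _ => hε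
  have hpiece : ∀ n, (∫⁻ t in P n, ‖deriv f t‖ₑ) ≤
      μH[1] (f '' P n) + (ε + ε : ℝ≥0) * volume (P n) := by
    intro n
    calc (∫⁻ t in P n, ‖deriv f t‖ₑ) ≤ ∫⁻ _ in P n, (‖A n 1‖ₑ + ε) := by
          refine setLIntegral_mono_ae' (hPm n) ?_
          filter_upwards [ae_norm_deriv_sub_norm_le_of_approximatesLinearOn (happ n)
            fun x hx => hd x (mem_iUnion_of_mem n hx)] with x hx hxP
          exact (hx hxP).1
      _ = ‖A n 1‖ₑ * volume (P n) + ε * volume (P n) := by rw [setLIntegral_const, add_mul]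
      _ ≤ μH[1] (f '' P n) + ε * volume (P n) + ε * volume (P n) := by
        gcongr
        exact le_hausdorffMeasure_image_of_approximatesLinearOn (happ n)
      _ = _ := by rw [ENNReal.coe_add, add_mul, add_assoc]
  rw [lintegral_iUnion hPm hP, measure_image_iUnion_of_injOn _ hP hPm
    (fun x hx => (hd x hx).continuousAt.continuousWithinAt) hi, measure_iUnion hP hPm,
    ← ENNReal.tsum_mul_left, ← ENNReal.tsum_add]
  exact ENNReal.tsum_le_tsum hpiece

lemma hausdorffMeasure_image_le_lintegral {T : Set ℝ} (hT : MeasurableSet T)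
    (hd : ∀ x ∈ T, DifferentiableAt ℝ f x) :
    μH[1] (f '' T) ≤ ∫⁻ t in T, ‖deriv f t‖ₑ := by
  obtain ⟨P, hP, hPm, rfl, hPv⟩ := exists_measurable_partition_measure_ne_top volume hT
  rw [image_iUnion, lintegral_iUnion hPm hP]
  exact (measure_iUnion_le _).trans (ENNReal.tsum_le_tsum fun k =>
    le_of_forall_le_add_mul (hPv k) fun ε hε =>
      hausdorffMeasure_image_le_lintegral_add (hPm k)
        (fun x hx => hd x (mem_iUnion_of_mem k hx)) hε)

theorem hausdorffMeasure_image_eq_lintegral {T : Set ℝ} (hT : MeasurableSet T)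
    (hd : ∀ x ∈ T, DifferentiableAt ℝ f x) (hi : InjOn f T) :
    μH[1] (f '' T) = ∫⁻ t in T, ‖deriv f t‖ₑ := by
  refine le_antisymm (hausdorffMeasure_image_le_lintegral hT hd) ?_
  obtain ⟨P, hP, hPm, rfl, hPv⟩ := exists_measurable_partition_measure_ne_top volume hT
  rw [lintegral_iUnion hPm hP, measure_image_iUnion_of_injOn _ hP hPm
    (fun x hx => (hd x hx).continuousAt.continuousWithinAt) hi]
  exact ENNReal.tsum_le_tsum fun k =>
    le_of_forall_le_add_mul (hPv k) fun ε hε =>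
      lintegral_le_hausdorffMeasure_image_add (hPm k)
        (fun x hx => hd x (mem_iUnion_of_mem k hx)) (hi.mono (subset_iUnion P k)) hε

end CurveLength

lemma hausdorffMeasure_image_setOf_not_differentiableAt {F : Type*} [NormedAddCommGroup F]
    [NormedSpace ℝ F] [FiniteDimensional ℝ F] [MeasurableSpace F] [BorelSpace F] {f : ℝ → F}
    {C : ℝ≥0} (hf : LipschitzWith C f) : μH[1] (f '' {t | ¬ DifferentiableAt ℝ f t}) = 0 := by
  refine le_antisymm ((hf.hausdorffMeasure_image_le zero_le_one _).trans ?_) zero_le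
  rw [hausdorffMeasure_real, ae_iff.1 hf.ae_differentiableAt, mul_zero]

lemma hausdorffMeasure_image_setOf_deriv_eq_zero {F : Type*} [NormedAddCommGroup F]
    [NormedSpace ℝ F] [CompleteSpace F] [SecondCountableTopology F] [MeasurableSpace F]
    [BorelSpace F] (f : ℝ → F) :
    μH[1] (f '' {t | DifferentiableAt ℝ f t ∧ deriv f t = 0}) = 0 := by
  have hm : MeasurableSet {t | DifferentiableAt ℝ f t ∧ deriv f t = 0} :=
    (measurableSet_of_differentiableAt ℝ f).inter (measurable_deriv f (measurableSet_singleton 0))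
  refine le_antisymm ((hausdorffMeasure_image_le_lintegral hm fun t ht => ht.1).trans ?_) zero_le
  rw [setLIntegral_congr_fun (g := fun _ => 0) hm, lintegral_zero]
  intro t ht
  simp [show deriv f t = 0 from ht.2]

/-! ### Parametrization of rectifiable sets -/

/-- `f` parametrizes a rectifiable set injectively, with nonzero velocity, by the times in `T`,
and its velocity is tangent to every set that it runs in. -/
structure IsParam (f : ℝ → Plane) (T : Set ℝ) : Prop where
  measurable : Measurable f
  measurableSet : MeasurableSet T
  injOn : InjOn f T
  differentiableAt : ∀ t ∈ T, DifferentiableAt ℝ f t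
  deriv_ne_zero : ∀ t ∈ T, deriv f t ≠ 0
  normal : ∀ A ν, IsUnitNormalField A ν →
    ∀ᵐ t : ℝ, t ∈ T → f t ∈ A → inner ℝ (ν (f t)) (deriv f t) = 0

/-- From each piece, drop the points whose value is already taken on an earlier piece. -/
lemma exists_injOn_image_eq_iUnion {α β : Type*} [MeasurableSpace α] [StandardBorelSpace α]
    [MeasurableSpace β] [MeasurableSpace.CountablySeparated β] {f : α → β} (hf : Measurable f)
    {P : ℕ → Set α} (hPm : ∀ n, MeasurableSet (P n)) (hPi : ∀ n, InjOn f (P n)) :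
    ∃ T ⊆ ⋃ n, P n, MeasurableSet T ∧ InjOn f T ∧ f '' T = f '' ⋃ n, P n := by
  have himg : ∀ n, MeasurableSet (f '' P n) := fun n =>
    (hPm n).image_of_measurable_injOn hf (hPi n)
  refine ⟨⋃ n, (P n \ ⋃ k < n, f ⁻¹' (f '' P k)), iUnion_mono fun n => sdiff_subset,
    .iUnion fun n => (hPm n).diff (.iUnion fun k => .iUnion fun _ => hf (himg k)), ?_,
    (image_mono (iUnion_mono fun n => sdiff_subset)).antisymm ?_⟩
  · intro x hx y hy hxy
    obtain ⟨n, hxn, hxn'⟩ := mem_iUnion.1 hx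
    obtain ⟨m, hym, hym'⟩ := mem_iUnion.1 hy
    rcases lt_trichotomy n m with h | rfl | h
    · exact (hym' (mem_iUnion₂_of_mem h ⟨x, hxn, hxy⟩)).elim
    · exact hPi n hxn hym hxy
    · exact (hxn' (mem_iUnion₂_of_mem h ⟨y, hym, hxy.symm⟩)).elim
  · rintro _ ⟨x, hx, rfl⟩
    have hex : ∃ n, f x ∈ f '' P n := (mem_iUnion.1 hx).imp fun n hn => ⟨x, hn, rfl⟩
    classical
    obtain ⟨y, hy, hyx⟩ := Nat.find_spec hex
    refine ⟨y, mem_iUnion.2 ⟨Nat.find hex, hy, fun H => ?_⟩, hyx⟩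
    obtain ⟨k, hk, hk'⟩ := mem_iUnion₂.1 H
    exact Nat.find_min hex hk (hyx ▸ hk')

lemma fderiv_injective_of_deriv_ne_zero {F : Type*} [NormedAddCommGroup F] [NormedSpace ℝ F]
    {f : ℝ → F} {t : ℝ} (h : deriv f t ≠ 0) : Function.Injective (fderiv ℝ f t) := by
  refine (injective_iff_map_eq_zero _).2 fun s hs => ?_
  rw [fderiv_eq_smul_deriv, smul_eq_zero] at hs
  exact hs.resolve_right h

lemma exists_injOn_image_eq {F : Type*} [NormedAddCommGroup F] [NormedSpace ℝ F]
    [SecondCountableTopology F] [MeasurableSpace F] [BorelSpace F] {f : ℝ → F}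
    (hf : Measurable f) {S : Set ℝ} (hS : MeasurableSet S)
    (hd : ∀ x ∈ S, DifferentiableAt ℝ f x) (hd0 : ∀ x ∈ S, deriv f x ≠ 0) :
    ∃ T ⊆ S, MeasurableSet T ∧ InjOn f T ∧ f '' T = f '' S := by
  obtain ⟨P, -, hPm, rfl, hP⟩ := exists_measurable_partition_antilipschitzWith hS hd
    fun x hx => fderiv_injective_of_deriv_ne_zero (hd0 x hx)
  refine exists_injOn_image_eq_iUnion hf hPm fun n => ?_
  obtain ⟨K, hK⟩ := hP n
  exact injOn_iff_injective.2 hK.injective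

section Concatenation

variable (e : ℤ ≃ ℕ × ℤ) (γ : ℕ → ℝ → Plane)

/-- A single curve that runs through all the curves `γ i`: during `[j, j + 1)` it follows `γ i`
over the times in `[k, k + 1)`, where `e j = (i, k)`. -/
def concatCurve (t : ℝ) : Plane := γ (e ⌊t⌋).1 (t + ((e ⌊t⌋).2 - ⌊t⌋))

lemma measurable_concatCurve (hγ : ∀ i, Continuous (γ i)) : Measurable (concatCurve e γ) := by
  have huncurry : Measurable (fun p : ℕ × ℝ => γ p.1 p.2) :=
    measurable_from_prod_countable_right fun i => (hγ i).measurable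
  have hindex : Measurable fun t : ℝ => e ⌊t⌋ :=
    (Measurable.of_discrete (f := e)).comp Int.measurable_floor
  have hshift : Measurable fun t : ℝ => (((e ⌊t⌋).2 - ⌊t⌋ : ℝ)) :=
    (Measurable.of_discrete (f := fun j : ℤ => (((e j).2 - j : ℝ)))).comp Int.measurable_floor
  exact huncurry.comp ((measurable_fst.comp hindex).prodMk (measurable_id.add hshift))

lemma concatCurve_eventuallyEq {t : ℝ} (ht : t ∉ range ((↑) : ℤ → ℝ)) :
    concatCurve e γ =ᶠ[nhds t] fun s => γ (e ⌊t⌋).1 (s + ((e ⌊t⌋).2 - ⌊t⌋)) := by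
  have hlt : (⌊t⌋ : ℝ) < t := lt_of_le_of_ne (Int.floor_le t) fun h => ht ⟨_, h⟩
  filter_upwards [Ioo_mem_nhds hlt (Int.lt_floor_add_one t)] with s hs
  rw [concatCurve, Int.floor_eq_iff.2 ⟨hs.1.le, hs.2⟩]

lemma exists_concatCurve_eq (i : ℕ) (u : ℝ) : ∃ t, concatCurve e γ t = γ i u := by
  refine ⟨e.symm (i, ⌊u⌋) + Int.fract u, ?_⟩
  have hfloor : ⌊(e.symm (i, ⌊u⌋) : ℝ) + Int.fract u⌋ = e.symm (i, ⌊u⌋) := by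
    rw [Int.floor_intCast_add, Int.floor_fract, add_zero]
  rw [concatCurve, hfloor, e.apply_symm_apply]
  congr 1
  linarith [Int.fract_add_floor u]

variable {γ}

lemma ae_inner_deriv_concatCurve_eq_zero (hγ : ∀ i, ∃ C : ℝ≥0, LipschitzWith C (γ i))
    {A : Set Plane} {ν : Plane → Plane} (hν : IsUnitNormalField A ν) :
    ∀ᵐ t : ℝ, t ∉ range ((↑) : ℤ → ℝ) → concatCurve e γ t ∈ A →
      inner ℝ (ν (concatCurve e γ t)) (deriv (concatCurve e γ) t) = 0 := by
  have hshift : ∀ j : ℤ, ∀ᵐ t : ℝ, γ (e j).1 (t + ((e j).2 - j)) ∈ A →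
      inner ℝ (ν (γ (e j).1 (t + ((e j).2 - j)))) (deriv (γ (e j).1) (t + ((e j).2 - j))) = 0 :=
    fun j => (measurePreserving_add_right volume ((e j).2 - j : ℝ)).quasiMeasurePreserving.ae
      (hν.2 (γ (e j).1) (hγ _))
  filter_upwards [ae_all_iff.2 hshift] with t ht htI htA
  have heq := concatCurve_eventuallyEq e γ htI
  have hderiv := heq.deriv_eq
  rw [deriv_comp_add_const] at hderiv
  rw [hderiv, heq.eq_of_nhds]
  exact ht _ (heq.eq_of_nhds ▸ htA)

lemma hausdorffMeasure_iUnion_range_diff_image_concatCurve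
    (hγ : ∀ i, ∃ C : ℝ≥0, LipschitzWith C (γ i)) :
    μH[1] ((⋃ i, range (γ i)) \ concatCurve e γ ''
      {t | t ∉ range ((↑) : ℤ → ℝ) ∧ DifferentiableAt ℝ (concatCurve e γ) t ∧
        deriv (concatCurve e γ) t ≠ 0}) = 0 := by
  have hint : μH[1] (concatCurve e γ '' range ((↑) : ℤ → ℝ)) = 0 := by
    have : NullSingletonClass (μH[1] : Measure Plane) :=
      Measure.nullSingletonClass_hausdorff _ one_pos
    exact ((countable_range _).image _).measure_zero _
  have hcorner : ∀ i, μH[1] (γ i '' {u | ¬ DifferentiableAt ℝ (γ i) u}) = 0 := fun i =>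
    hausdorffMeasure_image_setOf_not_differentiableAt (hγ i).choose_spec
  refine measure_mono_null ?_ (measure_union_null (measure_iUnion_null hcorner)
    (measure_union_null hint (hausdorffMeasure_image_setOf_deriv_eq_zero (concatCurve e γ))))
  rintro x ⟨hx, hxr⟩
  obtain ⟨i, u, rfl⟩ := mem_iUnion.1 hx
  obtain ⟨t, ht⟩ := exists_concatCurve_eq e γ i u
  rw [← ht] at hxr ⊢
  by_cases htI : t ∈ range ((↑) : ℤ → ℝ)
  · exact Or.inr (Or.inl ⟨t, htI, rfl⟩)
  by_cases htD : DifferentiableAt ℝ (concatCurve e γ) t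
  · exact Or.inr (Or.inr ⟨t, ⟨htD, by_contra fun h => hxr ⟨t, ⟨htI, htD, h⟩, rfl⟩⟩, rfl⟩)
  · refine Or.inl (mem_iUnion.2 ⟨(e ⌊t⌋).1, t + ((e ⌊t⌋).2 - ⌊t⌋), fun h => htD ?_, rfl⟩)
    refine (concatCurve_eventuallyEq e γ htI).differentiableAt_iff.2 ?_
    exact DifferentiableAt.comp t (f := fun s : ℝ => s + (((e ⌊t⌋).2 : ℝ) - ⌊t⌋)) h (by fun_prop)

end Concatenation

theorem exists_isParam {B : Set Plane} (hB : MeasurableSet B) (hr : IsRectifiable B) :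
    ∃ f T, IsParam f T ∧ f '' T ⊆ B ∧ μH[1] (B \ f '' T) = 0 := by
  obtain ⟨γ, hγ, hB0⟩ := hr
  obtain ⟨e⟩ : Nonempty (ℤ ≃ ℕ × ℤ) := nonempty_equiv_of_countable
  set f := concatCurve e γ
  have hfm : Measurable f := measurable_concatCurve e γ fun i => (hγ i).choose_spec.continuous
  set R : Set ℝ := {t | t ∉ range ((↑) : ℤ → ℝ) ∧ DifferentiableAt ℝ f t ∧ deriv f t ≠ 0}
  have hR : MeasurableSet R := (countable_range _).measurableSet.compl.inter
    ((measurableSet_of_differentiableAt ℝ f).inter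
      (measurable_deriv f (measurableSet_singleton 0).compl))
  obtain ⟨T, hTS, hTm, hTi, hTimg⟩ := exists_injOn_image_eq hfm (hR.inter (hfm hB))
    (fun t ht => ht.1.2.1) (fun t ht => ht.1.2.2)
  refine ⟨f, T, ⟨hfm, hTm, hTi, fun t ht => (hTS ht).1.2.1, fun t ht => (hTS ht).1.2.2, ?_⟩, ?_, ?_⟩
  · intro A ν hν
    filter_upwards [ae_inner_deriv_concatCurve_eq_zero e hγ hν] with t ht htT
    exact ht (hTS htT).1.1
  · exact image_subset_iff.2 fun t ht => (hTS ht).2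
  · refine measure_mono_null ?_ (measure_union_null hB0
      (hausdorffMeasure_iUnion_range_diff_image_concatCurve e hγ))
    rintro x ⟨hxB, hxT⟩
    by_cases hx : x ∈ ⋃ i, range (γ i)
    · refine Or.inr ⟨hx, ?_⟩
      rintro ⟨t, ht, rfl⟩
      exact hxT (hTimg ▸ mem_image_of_mem f ⟨ht, hxB⟩)
    · exact Or.inl ⟨hxB, hx⟩

lemma ae_deriv_eq_zero_of_mem_of_hausdorffMeasure_eq_zero {F : Type*} [NormedAddCommGroup F]
    [NormedSpace ℝ F] [CompleteSpace F] [SecondCountableTopology F] [MeasurableSpace F]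
    [BorelSpace F] {γ : ℝ → F} (hγ : Measurable γ) {Z : Set F} (hZ : μH[1] Z = 0) :
    ∀ᵐ t : ℝ, DifferentiableAt ℝ γ t → γ t ∈ Z → deriv γ t = 0 := by
  set W := toMeasurable μH[1] Z
  set T : Set ℝ := ({t | DifferentiableAt ℝ γ t} ∩ deriv γ ⁻¹' {0}ᶜ) ∩ γ ⁻¹' W
  have hT : MeasurableSet T := ((measurableSet_of_differentiableAt ℝ γ).inter
    (measurable_deriv γ (measurableSet_singleton 0).compl)).inter
    (hγ (measurableSet_toMeasurable _ _))
  obtain ⟨P, -, -, hPT, hP⟩ := exists_measurable_partition_antilipschitzWith hT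
    (fun t ht => ht.1.1) fun t ht => fderiv_injective_of_deriv_ne_zero ht.1.2
  have hPnull : ∀ n, volume (P n) = 0 := by
    intro n
    obtain ⟨K, hK⟩ := hP n
    have himage : μH[1] (γ '' P n) = 0 := by
      refine measure_mono_null (image_subset_iff.2 fun t ht => ?_)
        ((measure_toMeasurable Z).trans hZ)
      exact (hPT ▸ mem_iUnion_of_mem n ht : t ∈ T).2
    have hle := hausdorffMeasure_le_of_antilipschitzWith_domRestrict hK zero_le_one
    rwa [himage, mul_zero, hausdorffMeasure_real, nonpos_iff_eq_zero] at hle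
  have hTnull : volume T = 0 := hPT ▸ measure_iUnion_null hPnull
  filter_upwards [measure_eq_zero_iff_ae_notMem.1 hTnull] with t ht htd htZ
  by_contra h
  exact ht ⟨⟨htd, h⟩, subset_toMeasurable _ _ htZ⟩

/-! ### Existence of the unit normal -/

section CommonTangent

variable {F : Type*} [NormedAddCommGroup F] [NormedSpace ℝ F] {f γ : ℝ → F} {P : Set ℝ} {K : ℝ≥0}
  {s τ : ℝ}

lemma isBigO_invFunOn_comp_sub (hP : AntilipschitzWith K (P.domRestrict f)) (hs : s ∈ P)
    (hγ : DifferentiableAt ℝ γ τ) (hτ : γ τ = f s) :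
    (fun t => Function.invFunOn f P (γ t) - s) =O[nhdsWithin τ (γ ⁻¹' (f '' P))]
      fun t => t - τ := by
  have hle : (fun t => Function.invFunOn f P (γ t) - s) =O[nhdsWithin τ (γ ⁻¹' (f '' P))]
      fun t => γ t - γ τ := by
    refine Asymptotics.IsBigO.of_bound K ?_
    filter_upwards [self_mem_nhdsWithin] with t ht
    have hdist := hP.le_mul_dist ⟨_, Function.invFunOn_mem ht⟩ ⟨s, hs⟩
    rwa [domRestrict_apply, domRestrict_apply, Function.invFunOn_eq ht, ← hτ, dist_eq_norm,
      Subtype.dist_eq, dist_eq_norm] at hdist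
  exact hle.trans (hγ.hasDerivAt.isBigO_sub.mono nhdsWithin_le_nhds)

/-- Two curves that meet at accumulated times have parallel velocities there. -/
lemma apply_deriv_eq_zero_of_accPt (hP : AntilipschitzWith K (P.domRestrict f)) (hs : s ∈ P)
    (hf : DifferentiableAt ℝ f s) (hγ : DifferentiableAt ℝ γ τ) (hτ : γ τ = f s)
    (hacc : AccPt τ (Filter.principal (γ ⁻¹' (f '' P)))) {φ : F →L[ℝ] ℝ}
    (hφ : φ (deriv f s) = 0) : φ (deriv γ τ) = 0 := by
  set S := γ ⁻¹' (f '' P)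
  set σ := fun t => Function.invFunOn f P (γ t)
  have hσ : (fun t => σ t - s) =O[nhdsWithin τ S] fun t => t - τ :=
    isBigO_invFunOn_comp_sub hP hs hγ hτ
  have hlim : Filter.Tendsto σ (nhdsWithin τ S) (nhds s) := by
    have hsub : Filter.Tendsto (fun t => t - τ) (nhdsWithin τ S) (nhds 0) :=
      ((continuous_sub_right τ).tendsto' τ 0 (sub_self τ)).mono_left nhdsWithin_le_nhds
    exact tendsto_sub_nhds_zero_iff.1 (hσ.trans_tendsto hsub)
  have hf_expand : (fun t => f (σ t) - f s - (σ t - s) • deriv f s) =o[nhdsWithin τ S]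
      fun t => t - τ :=
    ((hasDerivAt_iff_isLittleO.1 hf.hasDerivAt).comp_tendsto hlim).trans_isBigO hσ
  have hzero : HasDerivWithinAt (fun t => φ (γ t)) 0 S τ := by
    rw [hasDerivWithinAt_iff_isLittleO]
    refine Asymptotics.IsBigO.trans_isLittleO ?_ hf_expand
    refine (φ.isBigO_comp _ _).congr' ?_ .rfl
    filter_upwards [self_mem_nhdsWithin] with t ht
    rw [show f (σ t) = γ t from Function.invFunOn_eq ht, ← hτ, map_sub, map_sub, map_smul, hφ,
      smul_zero, smul_zero]
  exact hacc.uniqueDiffWithinAt.eq_deriv _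
    (φ.hasFDerivAt.comp_hasDerivAt τ hγ.hasDerivAt).hasDerivWithinAt hzero

end CommonTangent

lemma inner_eq_mul_add_mul (v w : Plane) : inner ℝ v w = v 0 * w 0 + v 1 * w 1 := by
  simp [PiLp.inner_apply, Fin.sum_univ_two, mul_comm]

lemma norm_sq_eq_sq_add_sq (v : Plane) : ‖v‖ ^ 2 = v 0 ^ 2 + v 1 ^ 2 :=
  (EuclideanSpace.real_norm_sq_eq v).trans (Fin.sum_univ_two _)

/-- The rotation by a right angle, which turns tangents of curves into normals. -/
def rotate (v : Plane) : Plane := !₂[-v 1, v 0]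

lemma inner_rotate_self (v : Plane) : inner ℝ (rotate v) v = 0 := by
  simp [inner_eq_mul_add_mul, rotate, mul_comm]

lemma norm_rotate (v : Plane) : ‖rotate v‖ = ‖v‖ := by
  rw [← sq_eq_sq₀ (norm_nonneg _) (norm_nonneg _), norm_sq_eq_sq_add_sq, norm_sq_eq_sq_add_sq]
  simp [rotate, add_comm]

open Classical in
/-- The normal field of the parametrized set `f '' T` obtained by rotating the unit tangent; its
value outside `f '' T` is an arbitrary unit vector. -/
def paramNormal (f : ℝ → Plane) (T : Set ℝ) (x : Plane) : Plane :=
  if x ∈ f '' T then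
    ‖deriv f (Function.invFunOn f T x)‖⁻¹ • rotate (deriv f (Function.invFunOn f T x))
  else EuclideanSpace.single 0 1

namespace IsParam

variable {f : ℝ → Plane} {T : Set ℝ} (hp : IsParam f T)

include hp

lemma norm_paramNormal (x : Plane) : ‖paramNormal f T x‖ = 1 := by
  by_cases hx : x ∈ f '' T
  · rw [paramNormal, if_pos hx, norm_smul, norm_inv, norm_norm, norm_rotate,
      inv_mul_cancel₀ (norm_ne_zero_iff.2 (hp.deriv_ne_zero _ (Function.invFunOn_mem hx)))]
  · simp [paramNormal, hx]

lemma paramNormal_apply {t : ℝ} (ht : t ∈ T) :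
    paramNormal f T (f t) = ‖deriv f t‖⁻¹ • rotate (deriv f t) := by
  rw [paramNormal, if_pos (mem_image_of_mem f ht), hp.injOn.leftInvOn_invFunOn ht]

theorem isUnitNormalField_paramNormal {A : Set Plane} (hA : μH[1] (A \ f '' T) = 0) :
    IsUnitNormalField A (paramNormal f T) := by
  obtain ⟨P, -, -, hPT, hP⟩ := exists_measurable_partition_antilipschitzWith hp.measurableSet
    hp.differentiableAt fun t ht => fderiv_injective_of_deriv_ne_zero (hp.deriv_ne_zero t ht)
  refine ⟨hp.norm_paramNormal, fun γ ⟨C, hγ⟩ => ?_⟩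
  filter_upwards [hγ.ae_differentiableAt,
    ae_deriv_eq_zero_of_mem_of_hausdorffMeasure_eq_zero hγ.continuous.measurable hA,
    ae_all_iff.2 fun n => ae_accPt_of_mem (γ ⁻¹' (f '' P n))] with t htd htnull htacc htA
  by_cases ht : γ t ∈ f '' T
  · obtain ⟨s, hs, hst⟩ := ht
    obtain ⟨n, hn⟩ := mem_iUnion.1 (hPT ▸ hs : s ∈ ⋃ n, P n)
    obtain ⟨K, hK⟩ := hP n
    have horth : innerSL ℝ (rotate (deriv f s)) (deriv γ t) = 0 :=
      apply_deriv_eq_zero_of_accPt hK hn (hp.differentiableAt s hs) htd hst.symm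
        (htacc n ⟨s, hn, hst⟩) (inner_rotate_self _)
    rw [← hst, hp.paramNormal_apply hs, inner_smul_left]
    exact mul_eq_zero_of_right _ horth
  · rw [htnull htd ⟨htA, ht⟩, inner_zero_right]

lemma isUnitNormalField_unitNormal {A : Set Plane} (hA : μH[1] (A \ f '' T) = 0) :
    IsUnitNormalField A (unitNormal A) := by
  have h : ∃ ν, IsUnitNormalField A ν := ⟨_, hp.isUnitNormalField_paramNormal hA⟩
  rw [unitNormal, dif_pos h]
  exact h.choose_spec

end IsParam

/-! ### Lines

The line `y = m x + c` is represented by the pair `(m, c)`; the vertical lines, a null set, are left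
out. -/

/-- The intercept of the line of slope `m` through a point, as a linear form. -/
def lineForm (m : ℝ) : Plane →L[ℝ] ℝ :=
  (EuclideanSpace.proj 1 : Plane →L[ℝ] ℝ) - m • (EuclideanSpace.proj 0 : Plane →L[ℝ] ℝ)

lemma lineForm_apply (m : ℝ) (x : Plane) : lineForm m x = x 1 - m * x 0 := rfl

lemma measurable_lineForm_apply (x : Plane) : Measurable fun m => lineForm m x := by
  simp only [lineForm_apply]
  fun_prop

/-- The density with respect to `dm dc` of the measure on the lines `y = m x + c` that is invariant
under rigid motions. -/
def lineDensity (m : ℝ) : ℝ := (√(1 + m ^ 2) ^ 3)⁻¹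

lemma continuous_lineDensity : Continuous lineDensity := by
  refine Continuous.inv₀ (by fun_prop) fun m => ?_
  have : 0 < √(1 + m ^ 2) := Real.sqrt_pos.2 (by positivity)
  positivity

lemma measurable_lineDensity : Measurable lineDensity := continuous_lineDensity.measurable

lemma lineDensity_nonneg (m : ℝ) : 0 ≤ lineDensity m := by
  unfold lineDensity; positivity

lemma hasDerivAt_lineDensity_primitive (a b m : ℝ) :
    HasDerivAt (fun m => (b * m + a) / √(1 + m ^ 2)) (lineDensity m * (b - m * a)) m := by
  have hpos : 0 < 1 + m ^ 2 := by positivity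
  have hsqrt : HasDerivAt (fun m : ℝ => √(1 + m ^ 2)) (2 * m / (2 * √(1 + m ^ 2))) m := by
    refine HasDerivAt.sqrt ?_ hpos.ne'
    simpa using (hasDerivAt_pow 2 m).const_add 1
  have hlin : HasDerivAt (fun m : ℝ => b * m + a) b m := by
    simpa using ((hasDerivAt_id m).const_mul b).add_const a
  have hsqrt_pos : 0 < √(1 + m ^ 2) := Real.sqrt_pos.2 hpos
  refine (hlin.div hsqrt hsqrt_pos.ne').congr_deriv ?_
  unfold lineDensity
  field_simp
  rw [Real.sq_sqrt hpos.le]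
  ring

lemma tendsto_lineDensity_primitive (a b : ℝ) :
    Filter.Tendsto (fun m => (b * m + a) / √(1 + m ^ 2)) Filter.atTop (nhds b) := by
  have hlim : Filter.Tendsto (fun m : ℝ => (b + a * m⁻¹) / √(m⁻¹ ^ 2 + 1)) Filter.atTop
      (nhds ((b + a * 0) / √(0 ^ 2 + 1))) := by
    have hinv := tendsto_inv_atTop_zero (𝕜 := ℝ)
    exact ((hinv.const_mul a).const_add b).div (((hinv.pow 2).add_const 1).sqrt) (by simp)
  rw [show (b + a * 0) / √(0 ^ 2 + 1) = b by simp] at hlim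
  refine hlim.congr' ?_
  filter_upwards [Filter.eventually_gt_atTop 0] with m hm
  have hsqrt : √(1 + m ^ 2) = m * √(m⁻¹ ^ 2 + 1) := by
    rw [show 1 + m ^ 2 = m ^ 2 * (m⁻¹ ^ 2 + 1) by field_simp,
      Real.sqrt_mul (by positivity), Real.sqrt_sq hm.le]
  have : 0 < √(m⁻¹ ^ 2 + 1) := Real.sqrt_pos.2 (by positivity)
  rw [hsqrt]
  field_simp

lemma setLIntegral_lineDensity_mul {a b m₀ : ℝ} (h : ∀ m > m₀, 0 ≤ b - m * a) :
    0 ≤ b - (b * m₀ + a) / √(1 + m₀ ^ 2) ∧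
    ∫⁻ m in Ioi m₀, ENNReal.ofReal (lineDensity m * |b - m * a|) =
      ENNReal.ofReal (b - (b * m₀ + a) / √(1 + m₀ ^ 2)) := by
  have hpos : ∀ m ∈ Ioi m₀, 0 ≤ lineDensity m * (b - m * a) := fun m hm =>
    mul_nonneg (lineDensity_nonneg m) (h m hm)
  have hintegral := integrableOn_Ioi_deriv_of_nonneg' (a := m₀)
    (fun m _ => hasDerivAt_lineDensity_primitive a b m) hpos (tendsto_lineDensity_primitive a b)
  have hval := integral_Ioi_of_hasDerivAt_of_nonneg' (a := m₀)
    (fun m _ => hasDerivAt_lineDensity_primitive a b m) hpos (tendsto_lineDensity_primitive a b)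
  refine ⟨hval ▸ setIntegral_nonneg measurableSet_Ioi hpos, ?_⟩
  rw [← hval, ofReal_integral_eq_lintegral_ofReal hintegral]
  · refine setLIntegral_congr_fun measurableSet_Ioi fun m hm => ?_
    rw [abs_of_nonneg (h m hm)]
  · exact (ae_restrict_iff' measurableSet_Ioi).2 (Filter.Eventually.of_forall hpos)

lemma lineDensity_neg (m : ℝ) : lineDensity (-m) = lineDensity m := by simp [lineDensity]

lemma lintegral_eq_add_Ioi_neg (F : ℝ → ℝ≥0∞) (m₀ : ℝ) :
    ∫⁻ m, F m = (∫⁻ m in Ioi m₀, F m) + ∫⁻ m in Ioi (-m₀), F (-m) := by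
  have hneg : ∫⁻ m in Ioi (-m₀), F (-m) = ∫⁻ m in Iio m₀, F m := by
    have h := (Measure.measurePreserving_neg (volume : Measure ℝ)).setLIntegral_comp_preimage_emb
      (MeasurableEquiv.neg ℝ).measurableEmbedding F (Iio m₀)
    rwa [show Neg.neg ⁻¹' Iio m₀ = Ioi (-m₀) by ext; simp] at h
  rw [hneg, ← lintegral_add_compl F (measurableSet_Ioi (a := m₀)), compl_Ioi,
    setLIntegral_congr (Iio_ae_eq_Iic (a := m₀)).symm]

lemma lintegral_lineDensity_mul_of_neg {a b : ℝ} (ha : a < 0) :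
    ∫⁻ m, ENNReal.ofReal (lineDensity m * |b - m * a|) =
      ENNReal.ofReal (2 * √(a ^ 2 + b ^ 2)) := by
  have habs : ∀ m : ℝ, |b - -m * a| = |-b - m * a| := fun m => by
    rw [← abs_neg]; congr 1; ring
  have ha' : a ≠ 0 := ha.ne
  have hright := setLIntegral_lineDensity_mul (a := a) (b := b) (m₀ := b / a) fun m hm => by
    rw [gt_iff_lt, div_lt_iff_of_neg ha] at hm
    linarith
  have hleft := setLIntegral_lineDensity_mul (a := a) (b := -b) (m₀ := -(b / a)) fun m hm => by
    rw [gt_iff_lt, neg_lt, lt_div_iff_of_neg ha] at hm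
    linarith
  rw [lintegral_eq_add_Ioi_neg _ (b / a)]
  simp_rw [lineDensity_neg, habs]
  rw [hright.2, hleft.2, ← ENNReal.ofReal_add hright.1 hleft.1]
  congr 1
  have : 0 < √(1 + (b / a) ^ 2) := Real.sqrt_pos.2 (by positivity)
  have hsqrt : √(a ^ 2 + b ^ 2) = -a * √(1 + (b / a) ^ 2) := by
    rw [show a ^ 2 + b ^ 2 = (-a) ^ 2 * (1 + (b / a) ^ 2) by field_simp,
      Real.sqrt_mul (by positivity), Real.sqrt_sq (by linarith)]
  have hnum : b * (b / a) + a = a * √(1 + (b / a) ^ 2) ^ 2 := by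
    rw [Real.sq_sqrt (by positivity)]
    field_simp
    ring
  rw [hsqrt, neg_sq, show -b * -(b / a) + a = b * (b / a) + a by ring, hnum]
  field_simp
  ring

lemma lintegral_lineDensity_mul_of_nonneg {b : ℝ} (hb : 0 ≤ b) :
    ∫⁻ m, ENNReal.ofReal (lineDensity m * b) = ENNReal.ofReal (2 * b) := by
  have hhalf := setLIntegral_lineDensity_mul (a := 0) (b := b) (m₀ := 0)
    fun m _ => by simpa using hb
  simp only [mul_zero, add_zero, zero_div, sub_zero, abs_of_nonneg hb] at hhalf
  rw [lintegral_eq_add_Ioi_neg _ 0]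
  simp_rw [lineDensity_neg]
  rw [neg_zero, hhalf.2, ← ENNReal.ofReal_add hb hb, two_mul]

lemma lintegral_lineDensity_mul (a b : ℝ) :
    ∫⁻ m, ENNReal.ofReal (lineDensity m * |b - m * a|) =
      ENNReal.ofReal (2 * √(a ^ 2 + b ^ 2)) := by
  rcases lt_trichotomy a 0 with ha | rfl | ha
  · exact lintegral_lineDensity_mul_of_neg ha
  · simp_rw [mul_zero, sub_zero]
    rw [lintegral_lineDensity_mul_of_nonneg (abs_nonneg b), zero_pow two_ne_zero, zero_add,
      Real.sqrt_sq_eq_abs]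
  · have hneg : ∀ m, |b - m * a| = |-b - m * -a| := fun m => by rw [← abs_neg]; congr 1; ring
    simp_rw [hneg]
    rw [lintegral_lineDensity_mul_of_neg (neg_lt_zero.2 ha), neg_sq, neg_sq]

/-- The intercepts of the lines of slope `m` that meet a segment of direction `v` fill an interval
of length `|lineForm m v|`, so that this is Crofton's formula for a segment. -/
theorem lintegral_lineDensity_mul_lineForm (v : Plane) :
    ∫⁻ m, ENNReal.ofReal (lineDensity m * |lineForm m v|) = 2 * ‖v‖ₑ := by
  simp only [lineForm_apply]
  rw [lintegral_lineDensity_mul, ← norm_sq_eq_sq_add_sq, Real.sqrt_sq (norm_nonneg v),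
    ENNReal.ofReal_mul zero_le_two, ofReal_norm, ENNReal.ofReal_ofNat]

/-! ### Moments of the number of crossings of a parametrized set with lines -/

section Crossings

variable {f : ℝ → Plane} {T : Set ℝ}

/-- A pair of a slope and a time, mapped to the line of that slope through the point at that
time. -/
def lineThrough (f : ℝ → Plane) (p : ℝ × ℝ) : ℝ × ℝ := (p.1, lineForm p.1 (f p.2))

lemma measurable_coord (hf : Measurable f) (k : Fin 2) : Measurable fun t => f t k :=
  (EuclideanSpace.proj k : Plane →L[ℝ] ℝ).continuous.measurable.comp hf

lemma hasDerivAt_coord {t : ℝ} (hd : DifferentiableAt ℝ f t) (k : Fin 2) :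
    HasDerivAt (fun t => f t k) (deriv f t k) t :=
  (EuclideanSpace.proj k : Plane →L[ℝ] ℝ).hasFDerivAt.comp_hasDerivAt t hd.hasDerivAt

lemma measurable_uncurry_lineForm (hf : Measurable f) :
    Measurable fun p : ℝ × ℝ => lineForm p.1 (f p.2) := by
  have := measurable_coord hf
  simp only [lineForm_apply]
  fun_prop

lemma measurable_lineThrough (hf : Measurable f) : Measurable (lineThrough f) :=
  measurable_fst.prodMk (measurable_uncurry_lineForm hf)

lemma hasFDerivAt_lineThrough {p : ℝ × ℝ} (hd : DifferentiableAt ℝ f p.2) :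
    HasFDerivAt (lineThrough f) (LinearMap.toContinuousLinearMap
      (Matrix.toLin (Module.Basis.finTwoProd ℝ) (Module.Basis.finTwoProd ℝ)
        !![1, 0; -(f p.2 0), lineForm p.1 (deriv f p.2)])) p := by
  have hcoord : ∀ k, HasFDerivAt (fun p : ℝ × ℝ => f p.2 k)
      (deriv f p.2 k • ContinuousLinearMap.snd ℝ ℝ ℝ) p := fun k =>
    (hasDerivAt_coord hd k).comp_hasFDerivAt p hasFDerivAt_snd
  have h := (hasFDerivAt_fst (𝕜 := ℝ) (p := p)).prodMk
    ((hcoord 1).sub (hasFDerivAt_fst.mul (hcoord 0)))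
  rw [Matrix.toLin_finTwoProd_toContinuousLinearMap]
  refine h.congr_fderiv ?_
  ext <;> simp [lineForm_apply]

lemma differentiableAt_lineThrough (hd : ∀ t ∈ T, DifferentiableAt ℝ f t) :
    ∀ p ∈ (univ : Set ℝ) ×ˢ T, DifferentiableAt ℝ (lineThrough f) p :=
  fun p hp => (hasFDerivAt_lineThrough (hd p.2 hp.2)).differentiableAt

lemma det_fderiv_lineThrough {p : ℝ × ℝ} (hd : DifferentiableAt ℝ f p.2) :
    (fderiv ℝ (lineThrough f) p).det = lineForm p.1 (deriv f p.2) := by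
  rw [(hasFDerivAt_lineThrough hd).fderiv]
  simp only [LinearMap.det_toContinuousLinearMap, LinearMap.det_toLin, Matrix.det_fin_two_of]
  ring

/-- The number of crossings, weighted by `ϑ`, of the parametrized set with the line of slope `p.1`
and intercept `p.2`. -/
def paramCrossings (f : ℝ → Plane) (T : Set ℝ) (ϑ : ℝ → ℝ≥0∞) (p : ℝ × ℝ) : ℝ≥0∞ :=
  fiberSum (fun t => lineForm p.1 (f t)) T ϑ p.2

lemma fiberSum_lineThrough (f : ℝ → Plane) (T : Set ℝ) (ϑ : ℝ → ℝ≥0∞) :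
    fiberSum (lineThrough f) (univ ×ˢ T) (ϑ ∘ Prod.snd) = paramCrossings f T ϑ := by
  funext p
  rw [paramCrossings, fiberSum, fiberSum, ENNReal.tsum_prod', tsum_eq_single p.1]
  · refine tsum_congr fun t => ?_
    by_cases h : t ∈ T ∩ (fun t => lineForm p.1 (f t)) ⁻¹' {p.2}
    · rw [indicator_of_mem h, indicator_of_mem]
      · rfl
      · exact ⟨⟨mem_univ _, h.1⟩, Prod.ext rfl h.2⟩
    · rw [indicator_of_notMem h, indicator_of_notMem]
      exact fun H => h ⟨H.1.2, congrArg Prod.snd H.2⟩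
  · intro m hm
    refine ENNReal.tsum_eq_zero.2 fun t => indicator_of_notMem ?_ _
    exact fun H => hm (congrArg Prod.fst H.2)

lemma aemeasurable_paramCrossings (hp : IsParam f T) {ϑ : ℝ → ℝ≥0∞} (hϑ : Measurable ϑ) :
    AEMeasurable (paramCrossings f T ϑ) := by
  rw [← fiberSum_lineThrough]
  exact aemeasurable_fiberSum volume (MeasurableSet.univ.prod hp.measurableSet)
    (differentiableAt_lineThrough hp.differentiableAt) (hϑ.comp measurable_snd)

lemma lintegral_mul_paramCrossings (hp : IsParam f T) {ϑ : ℝ → ℝ≥0∞} (hϑ : Measurable ϑ)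
    {G : ℝ × ℝ → ℝ≥0∞} (hG : Measurable G) :
    ∫⁻ p, G p * paramCrossings f T ϑ p =
      ∫⁻ t in T, ϑ t * ∫⁻ m, ENNReal.ofReal |lineForm m (deriv f t)| * G (m, lineForm m (f t)) := by
  have hS : MeasurableSet ((univ : Set ℝ) ×ˢ T) := MeasurableSet.univ.prod hp.measurableSet
  have hweight : Measurable fun p => G (lineThrough f p) * ϑ p.2 :=
    (hG.comp (measurable_lineThrough hp.measurable)).mul (hϑ.comp measurable_snd)
  have hjac : Measurable fun p : ℝ × ℝ => ENNReal.ofReal |lineForm p.1 (deriv f p.2)| *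
      (G (lineThrough f p) * ϑ p.2) :=
    (measurable_uncurry_lineForm (measurable_deriv f)).abs.ennreal_ofReal.mul hweight
  calc ∫⁻ p, G p * paramCrossings f T ϑ p
      = ∫⁻ p, fiberSum (lineThrough f) (univ ×ˢ T) (fun p => G (lineThrough f p) * ϑ p.2) p := by
        simp_rw [← fiberSum_lineThrough, ← fiberSum_comp_mul, Function.comp_apply]
    _ = ∫⁻ p in univ ×ˢ T, ENNReal.ofReal |(fderiv ℝ (lineThrough f) p).det| *
          (G (lineThrough f p) * ϑ p.2) :=
        lintegral_fiberSum volume hS (differentiableAt_lineThrough hp.differentiableAt) hweight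
    _ = ∫⁻ p in univ ×ˢ T, ENNReal.ofReal |lineForm p.1 (deriv f p.2)| *
          (G (lineThrough f p) * ϑ p.2) :=
        setLIntegral_congr_fun hS fun p hpT => by
          simp only [det_fderiv_lineThrough (hp.differentiableAt p.2 hpT.2)]
    _ = ∫⁻ t in T, ∫⁻ m, ENNReal.ofReal |lineForm m (deriv f t)| *
          (G (m, lineForm m (f t)) * ϑ t) := by
        rw [Measure.volume_eq_prod, ← Measure.prod_restrict, Measure.restrict_univ,
          lintegral_prod_symm _ hjac.aemeasurable]
        rfl
    _ = _ := lintegral_congr fun t => by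
        rw [← lintegral_const_mul]
        · exact lintegral_congr fun m => by ring
        · exact (measurable_lineForm_apply _).abs.ennreal_ofReal.mul
            (hG.comp (measurable_id.prodMk (measurable_lineForm_apply _)))

lemma lintegral_paramCrossings (hp : IsParam f T) {ϑ : ℝ → ℝ≥0∞} (hϑ : Measurable ϑ) :
    ∫⁻ p : ℝ × ℝ, ENNReal.ofReal (lineDensity p.1) * paramCrossings f T ϑ p =
      ∫⁻ t in T, ϑ t * (2 * ‖deriv f t‖ₑ) := by
  rw [lintegral_mul_paramCrossings hp hϑ (G := fun p => ENNReal.ofReal (lineDensity p.1))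
    (measurable_lineDensity.comp measurable_fst).ennreal_ofReal]
  refine lintegral_congr fun t => ?_
  rw [← lintegral_lineDensity_mul_lineForm]
  congr 1
  refine lintegral_congr fun m => ?_
  rw [mul_comm, ENNReal.ofReal_mul (lineDensity_nonneg m)]

/-- The oriented area spanned by two vectors. -/
def cross (u v : Plane) : ℝ := u 0 * v 1 - u 1 * v 0

/-- The energy of a pair of points of a parametrized set, with the arclength elements of both
included: it is `|n(x)·(y - x)| |n(y)·(y - x)| / ‖y - x‖³` times both speeds. -/
def paramKernel (f : ℝ → Plane) (t s : ℝ) : ℝ :=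
  |cross (deriv f t) (f s - f t)| * |cross (deriv f s) (f s - f t)| / ‖f s - f t‖ ^ 3

/-- The slope of the line through the points at times `t` and `s` (`0` on vertical lines). -/
def chordSlope (f : ℝ → Plane) (t s : ℝ) : ℝ := (f s 1 - f t 1) / (f s 0 - f t 0)

lemma lineForm_eq_lineForm_iff_div_eq {x y : Plane} (h : y 0 ≠ x 0) (m : ℝ) :
    lineForm m y = lineForm m x ↔ (y 1 - x 1) / (y 0 - x 0) = m := by
  rw [div_eq_iff (sub_ne_zero.2 h), lineForm_apply, lineForm_apply]
  constructor <;> intro h <;> linarith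

lemma eq_of_lineForm_eq {m : ℝ} {x y : Plane} (h : lineForm m y = lineForm m x)
    (h0 : y 0 = x 0) : y = x := by
  rw [lineForm_apply, lineForm_apply, h0] at h
  ext k
  fin_cases k
  · exact h0
  · exact sub_left_injective h

lemma paramCrossings_lineThrough (hi : InjOn f T) (ϑ : ℝ → ℝ≥0∞) {t : ℝ} (ht : t ∈ T) (m : ℝ) :
    paramCrossings f T ϑ (m, lineForm m (f t)) =
      ϑ t + fiberSum (chordSlope f t) (T ∩ {s | f s 0 ≠ f t 0}) ϑ m := by
  have hT : T = {t} ∪ (T \ {t}) := by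
    rw [union_sdiff_self, union_eq_right.2 (singleton_subset_iff.2 ht)]
  have hset : (T \ {t}) ∩ (fun s => lineForm m (f s)) ⁻¹' {lineForm m (f t)} =
      (T ∩ {s | f s 0 ≠ f t 0}) ∩ chordSlope f t ⁻¹' {m} := by
    ext s
    constructor
    · rintro ⟨⟨hs, hst⟩, hline⟩
      have h0 : f s 0 ≠ f t 0 := fun h0 => hst (hi hs ht (eq_of_lineForm_eq hline h0))
      exact ⟨⟨hs, h0⟩, (lineForm_eq_lineForm_iff_div_eq h0 m).1 hline⟩
    · rintro ⟨⟨hs, h0⟩, hslope⟩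
      exact ⟨⟨hs, fun hst => h0 (by rw [hst])⟩, (lineForm_eq_lineForm_iff_div_eq h0 m).2 hslope⟩
  rw [paramCrossings, hT, fiberSum_union disjoint_sdiff_right, ← hT]
  congr 1
  · exact fiberSum_apply_of_injOn (h := fun s => lineForm m (f s)) (injOn_singleton _ _) ϑ
      (mem_singleton t)
  · rw [fiberSum, fiberSum, hset]

lemma hasDerivAt_chordSlope {t s : ℝ} (hd : DifferentiableAt ℝ f s) (h0 : f s 0 ≠ f t 0) :
    HasDerivAt (chordSlope f t) (-cross (deriv f s) (f s - f t) / (f s - f t) 0 ^ 2) s := by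
  refine (((hasDerivAt_coord hd 1).sub_const (f t 1)).div
    ((hasDerivAt_coord hd 0).sub_const (f t 0)) (sub_ne_zero.2 h0)).congr_deriv ?_
  simp only [cross, PiLp.sub_apply]
  ring

lemma lineDensity_mul_eq {u v w : Plane} (hw : w 0 ≠ 0) :
    |-cross u w / w 0 ^ 2| * (lineDensity (w 1 / w 0) * |lineForm (w 1 / w 0) v|) =
      |cross v w| * |cross u w| / ‖w‖ ^ 3 := by
  have hsqrt : √(1 + (w 1 / w 0) ^ 2) = ‖w‖ / |w 0| := by
    rw [← Real.sqrt_sq (norm_nonneg w), norm_sq_eq_sq_add_sq, ← Real.sqrt_sq_eq_abs,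
      ← Real.sqrt_div (by positivity)]
    congr 1
    field_simp
  have hform : lineForm (w 1 / w 0) v = -cross v w / w 0 := by
    simp only [lineForm_apply, cross]; field_simp; ring
  have hnorm : ‖w‖ ≠ 0 := norm_ne_zero_iff.2 fun h => hw (by simp [h])
  have habs : |w 0| ≠ 0 := abs_ne_zero.2 hw
  rw [lineDensity, hsqrt, hform]
  simp only [abs_div, abs_neg, abs_pow]
  field_simp

lemma det_fderiv_eq_deriv (g : ℝ → ℝ) (s : ℝ) : (fderiv ℝ g s).det = deriv g s := by
  rw [← toSpanSingleton_deriv, ContinuousLinearMap.det_toSpanSingleton]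

lemma ae_deriv_coord_eq_zero (hp : IsParam f T) (c : ℝ) :
    ∀ᵐ s : ℝ, s ∈ T → f s 0 = c → deriv f s 0 = 0 := by
  have hcoord := fun s hs => hasDerivAt_coord (hp.differentiableAt s hs) 0
  have h := ae_det_fderiv_eq_zero_or_of_ae volume (h := fun s => f s 0)
    (measurable_coord hp.measurable 0) hp.measurableSet
    (fun s hs => (hcoord s hs).differentiableAt)
    (p := fun y => y ≠ c) (measure_eq_zero_iff_ae_notMem.1 (measure_singleton c))
  rw [ae_restrict_iff' hp.measurableSet] at h
  filter_upwards [h] with s hs hsT hsc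
  have hdet := (hs hsT).resolve_right (not_not.2 hsc)
  rwa [det_fderiv_eq_deriv, (hcoord s hsT).deriv] at hdet

lemma setLIntegral_paramKernel_eq_zero (hp : IsParam f T) (ϑ : ℝ → ℝ≥0∞) (t : ℝ) :
    ∫⁻ s in T \ {s | f s 0 ≠ f t 0}, ϑ s * ENNReal.ofReal (paramKernel f t s) = 0 := by
  have hm : MeasurableSet (T \ {s | f s 0 ≠ f t 0}) := hp.measurableSet.diff
    (measurable_coord hp.measurable 0 (measurableSet_singleton (f t 0)).compl)
  rw [setLIntegral_congr_fun_ae (g := fun _ => 0) hm, lintegral_zero]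
  filter_upwards [ae_deriv_coord_eq_zero hp (f t 0)] with s hs hsT
  have h0 : f s 0 = f t 0 := not_not.1 hsT.2
  have hcross : cross (deriv f s) (f s - f t) = 0 := by simp [cross, hs hsT.1 h0, h0]
  simp [paramKernel, hcross]

lemma measurable_lineDensity_mul_lineForm (v : Plane) :
    Measurable fun m => ENNReal.ofReal (lineDensity m * |lineForm m v|) :=
  (measurable_lineDensity.mul (measurable_lineForm_apply v).abs).ennreal_ofReal

/-- The area formula for `chordSlope f t`, whose level sets are the crossings of the set with the
lines through `f t`. -/
lemma lintegral_fiberSum_chordSlope (hp : IsParam f T) {ϑ : ℝ → ℝ≥0∞} (hϑ : Measurable ϑ) (t : ℝ) :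
    ∫⁻ m, ENNReal.ofReal (lineDensity m * |lineForm m (deriv f t)|) *
        fiberSum (chordSlope f t) (T ∩ {s | f s 0 ≠ f t 0}) ϑ m =
      ∫⁻ s in T, ϑ s * ENNReal.ofReal (paramKernel f t s) := by
  have hcoord := measurable_coord hp.measurable
  have hD : MeasurableSet {s | f s 0 ≠ f t 0} := hcoord 0 (measurableSet_singleton (f t 0)).compl
  have hS := hp.measurableSet.inter hD
  have hslope : Measurable (chordSlope f t) :=
    ((hcoord 1).sub_const _).div ((hcoord 0).sub_const _)
  set G : ℝ → ℝ≥0∞ := fun m => ENNReal.ofReal (lineDensity m * |lineForm m (deriv f t)|)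
  have hweight : Measurable fun s => G (chordSlope f t s) * ϑ s :=
    ((measurable_lineDensity_mul_lineForm _).comp hslope).mul hϑ
  have hderiv := fun s (hs : s ∈ T ∩ {s | f s 0 ≠ f t 0}) =>
    hasDerivAt_chordSlope (hp.differentiableAt s hs.1) hs.2
  rw [lintegral_congr fun m => (fiberSum_comp_mul _ ϑ G m).symm,
    lintegral_fiberSum volume hS (fun s hs => (hderiv s hs).differentiableAt) hweight,
    ← lintegral_inter_add_sdiff _ T hD, setLIntegral_paramKernel_eq_zero hp, add_zero]
  refine setLIntegral_congr_fun hS fun s hs => ?_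
  have h0 : (f s - f t) 0 ≠ 0 := sub_ne_zero.2 hs.2
  rw [det_fderiv_eq_deriv, (hderiv s hs).deriv, ← mul_assoc, ← ENNReal.ofReal_mul (abs_nonneg _),
    mul_comm, paramKernel, ← lineDensity_mul_eq h0]
  rfl

lemma ae_lineForm_deriv_eq_zero_or_of_ae (hp : IsParam f T) {P : ℝ × ℝ → Prop}
    (hP : ∀ᵐ p, P p) : ∀ᵐ t ∂volume.restrict T, ∀ᵐ m : ℝ,
      lineForm m (deriv f t) = 0 ∨ P (m, lineForm m (f t)) := by
  have h := ae_det_fderiv_eq_zero_or_of_ae (volume : Measure (ℝ × ℝ))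
    (measurable_lineThrough hp.measurable) (MeasurableSet.univ.prod hp.measurableSet)
    (differentiableAt_lineThrough hp.differentiableAt) hP
  rw [Measure.volume_eq_prod, ← Measure.prod_restrict, Measure.restrict_univ] at h
  filter_upwards [Measure.ae_ae_of_ae_prod
    (Measure.measurePreserving_swap.quasiMeasurePreserving.ae h),
    ae_restrict_mem hp.measurableSet] with t ht htT
  filter_upwards [ht] with m hm
  rwa [Prod.swap_prod_mk, det_fderiv_lineThrough (p := (m, t)) (hp.differentiableAt t htT)] at hm

/-- One factor `paramCrossings` is integrated along the set, where the lines through the point at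
time `t` are parametrized by their slopes; the other one then counts the point itself and the
chords that start there. -/
theorem lintegral_paramCrossings_sq (hp : IsParam f T) {ϑ : ℝ → ℝ≥0∞} (hϑ : Measurable ϑ) :
    ∫⁻ p : ℝ × ℝ, ENNReal.ofReal (lineDensity p.1) * paramCrossings f T ϑ p ^ 2 =
      ∫⁻ t in T, ϑ t * (2 * ‖deriv f t‖ₑ * ϑ t +
        ∫⁻ s in T, ϑ s * ENNReal.ofReal (paramKernel f t s)) := by
  obtain ⟨N, hNm, hN⟩ := aemeasurable_paramCrossings hp hϑ
  have hG : Measurable fun p : ℝ × ℝ => ENNReal.ofReal (lineDensity p.1) * N p :=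
    (measurable_lineDensity.comp measurable_fst).ennreal_ofReal.mul hNm
  have hsq : ∫⁻ p : ℝ × ℝ, ENNReal.ofReal (lineDensity p.1) * paramCrossings f T ϑ p ^ 2 =
      ∫⁻ p : ℝ × ℝ, ENNReal.ofReal (lineDensity p.1) * N p * paramCrossings f T ϑ p := by
    refine lintegral_congr_ae ?_
    filter_upwards [hN] with p hpN
    rw [sq, ← mul_assoc, ← hpN]
  rw [hsq, lintegral_mul_paramCrossings hp hϑ hG]
  refine lintegral_congr_ae ?_
  filter_upwards [ae_lineForm_deriv_eq_zero_or_of_ae hp hN, ae_restrict_mem hp.measurableSet]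
    with t ht htT
  have hm := measurable_lineDensity_mul_lineForm (deriv f t)
  rw [← lintegral_lineDensity_mul_lineForm, ← lintegral_mul_const _ hm,
    ← lintegral_fiberSum_chordSlope hp hϑ, ← lintegral_add_left (hm.mul_const _)]
  congr 1
  refine lintegral_congr_ae ?_
  filter_upwards [ht] with m hm
  rw [← mul_add, ← paramCrossings_lineThrough hp.injOn ϑ htT m,
    ENNReal.ofReal_mul (lineDensity_nonneg m)]
  rcases hm with htangent | hNm
  · simp [htangent]
  · rw [hNm]
    ring

end Crossings

/-! ### Crofton's formula and its quadratic version -/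

lemma IsParam.measurableSet_image {f : ℝ → Plane} {T : Set ℝ} (hp : IsParam f T) :
    MeasurableSet (f '' T) := hp.measurableSet.image_of_measurable_injOn hp.measurable hp.injOn

lemma IsParam.measurableEmbedding {f : ℝ → Plane} {T : Set ℝ} (hp : IsParam f T) :
    MeasurableEmbedding (T.domRestrict f) :=
  ContinuousOn.measurableEmbedding hp.measurableSet
    (fun t ht => (hp.differentiableAt t ht).continuousAt.continuousWithinAt) hp.injOn

lemma IsParam.restrict_hausdorffMeasure {f : ℝ → Plane} {T : Set ℝ} (hp : IsParam f T) :
    (μH[1] : Measure Plane).restrict (f '' T) =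
      ((Measure.comap ((↑) : T → ℝ) volume).withDensity fun t => ‖deriv f t‖ₑ).map
        (T.domRestrict f) := by
  ext E hE
  have hpre : MeasurableSet (T.domRestrict f ⁻¹' E) := hp.measurableEmbedding.measurable hE
  have himage : ((↑) : T → ℝ) '' (T.domRestrict f ⁻¹' E) = T ∩ f ⁻¹' E :=
    Subtype.image_preimage_coe T (f ⁻¹' E)
  rw [Measure.map_apply hp.measurableEmbedding.measurable hE, withDensity_apply _ hpre,
    setLIntegral_subtype hp.measurableSet _ fun t => ‖deriv f t‖ₑ, himage,
    ← hausdorffMeasure_image_eq_lintegral (hp.measurableSet.inter (hp.measurable hE))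
      (fun t ht => hp.differentiableAt t ht.1) (hp.injOn.mono inter_subset_left),
    image_inter_preimage, Measure.restrict_apply hE, inter_comm]

lemma IsParam.setLIntegral_image {f : ℝ → Plane} {T : Set ℝ} (hp : IsParam f T)
    (G : Plane → ℝ≥0∞) :
    ∫⁻ x in f '' T, G x ∂μH[1] = ∫⁻ t in T, ‖deriv f t‖ₑ * G (f t) := by
  rw [hp.restrict_hausdorffMeasure, hp.measurableEmbedding.lintegral_map,
    ← lintegral_subtype_comap hp.measurableSet]
  exact lintegral_withDensity_eq_lintegral_mul_non_measurable _
    ((measurable_deriv f).enorm.comp measurable_subtype_coe)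
    (Filter.Eventually.of_forall fun t => enorm_lt_top) _

lemma IsRectifiable.mono {A B : Set Plane} (hA : IsRectifiable A) (h : B ⊆ A) :
    IsRectifiable B := by
  obtain ⟨γ, hγ, hnull⟩ := hA
  exact ⟨γ, hγ, measure_mono_null (sdiff_subset_sdiff_left h) hnull⟩

/-- The number of points, counted with multiplicity `θ`, on the line of slope `m` and
intercept `c`. -/
def crossings (θ : Plane → ℕ) (m c : ℝ) : ℝ≥0∞ :=
  fiberSum (lineForm m) univ (fun x => (θ x : ℝ≥0∞)) c

/-- Integration over the nonvertical lines of the plane with respect to their invariant measure. -/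
def lineIntegral (F : ℝ → ℝ → ℝ≥0∞) : ℝ≥0∞ :=
  ∫⁻ m, ENNReal.ofReal (lineDensity m) * ∫⁻ c, F m c

lemma volume_lineForm_image_eq_zero {Z : Set Plane} (hZ : μH[1] Z = 0) (m : ℝ) :
    volume (lineForm m '' Z) = 0 := by
  rw [← hausdorffMeasure_real]
  refine le_antisymm (((lineForm m).lipschitz.hausdorffMeasure_image_le zero_le_one Z).trans ?_)
    zero_le
  rw [hZ, mul_zero]

lemma lineIntegral_eq_lintegral {F : ℝ → ℝ → ℝ≥0∞} {H : ℝ × ℝ → ℝ≥0∞} (hH : AEMeasurable H)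
    (h : ∀ m, ∀ᵐ c, F m c = H (m, c)) :
    lineIntegral F = ∫⁻ p : ℝ × ℝ, ENNReal.ofReal (lineDensity p.1) * H p := by
  rw [Measure.volume_eq_prod, lintegral_prod]
  · refine lintegral_congr fun m => ?_
    rw [lintegral_congr_ae (h m)]
    exact (lintegral_const_mul' _ _ ENNReal.ofReal_ne_top).symm
  · exact (measurable_lineDensity.comp measurable_fst).ennreal_ofReal.aemeasurable.mul hH

lemma abs_inner_mul_norm {ν u w : Plane} (hν : ‖ν‖ = 1) (hu : inner ℝ ν u = 0) :
    |inner ℝ ν w| * ‖u‖ = |cross u w| := by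
  have hunit : ν 0 ^ 2 + ν 1 ^ 2 = 1 := by rw [← norm_sq_eq_sq_add_sq, hν, one_pow]
  rw [inner_eq_mul_add_mul] at hu ⊢
  rw [← sq_eq_sq₀ (by positivity) (abs_nonneg _), mul_pow, sq_abs, sq_abs, norm_sq_eq_sq_add_sq,
    cross]
  set l := ν 0 * u 1 - ν 1 * u 0 with hl
  have hu0 : u 0 = -l * ν 1 := by linear_combination (-u 0) * hunit + ν 0 * hu + ν 1 * hl
  have hu1 : u 1 = l * ν 0 := by linear_combination (-u 1) * hunit + ν 1 * hu - ν 0 * hl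
  rw [hu0, hu1]
  linear_combination (l ^ 2 * (ν 0 * w 0 + ν 1 * w 1) ^ 2) * hunit

lemma energyKernel_mul_norm {ν : Plane → Plane} (hν : ∀ x, ‖ν x‖ = 1) {f : ℝ → Plane} {t s : ℝ}
    (ht : inner ℝ (ν (f t)) (deriv f t) = 0) (hs : inner ℝ (ν (f s)) (deriv f s) = 0) :
    ‖deriv f t‖ * ‖deriv f s‖ * energyKernel ν (f t) (f s) = paramKernel f t s := by
  rw [energyKernel, paramKernel, ← abs_inner_mul_norm (hν _) ht, ← abs_inner_mul_norm (hν _) hs,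
    abs_mul, norm_sub_rev, real_inner_comm (ν (f s))]
  ring

/-- `f` parametrizes by the times in `T`, up to a null set, the support of the multiplicity `θ`, and
`ϑ` is the multiplicity as a function of time. -/
structure IsMultisetParam (θ : Plane → ℕ) (f : ℝ → Plane) (T : Set ℝ) (ϑ : ℝ → ℝ≥0∞) : Prop where
  aemeasurable : AEMeasurable θ μH[1]
  isParam : IsParam f T
  image_subset : f '' T ⊆ Function.support θ
  hausdorffMeasure_sdiff : μH[1] (Function.support θ \ f '' T) = 0
  measurable : Measurable ϑ
  eq_natCast : ∀ t ∈ T, ϑ t = θ (f t)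

theorem exists_isMultisetParam {θ : Plane → ℕ} (hθ : AEMeasurable θ μH[1])
    (hr : IsRectifiable (Function.support θ)) : ∃ f T ϑ, IsMultisetParam θ f T ϑ := by
  obtain ⟨θ', hm, hae⟩ := id hθ
  set N := toMeasurable μH[1] {x | θ x ≠ θ' x}
  have heq : ∀ x ∉ N, θ x = θ' x := fun x hx => by
    by_contra h
    exact hx (subset_toMeasurable _ _ h)
  have hB : MeasurableSet (Function.support θ' \ N) :=
    (hm (measurableSet_singleton 0).compl).diff (measurableSet_toMeasurable _ _)
  have hsub : Function.support θ' \ N ⊆ Function.support θ := fun x hx => by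
    rw [Function.mem_support, heq x hx.2]; exact hx.1
  obtain ⟨f, T, hp, hfT, hnull⟩ := exists_isParam hB (hr.mono hsub)
  refine ⟨f, T, fun t => (θ' (f t) : ℝ≥0∞), hθ, hp, hfT.trans hsub, measure_mono_null ?_
    (measure_union_null ((measure_toMeasurable _).trans hae) hnull),
    measurable_from_top.comp (hm.comp hp.measurable), fun t ht => ?_⟩
  · rintro x ⟨hx, hxT⟩
    by_cases hxN : x ∈ N
    · exact Or.inl hxN
    · exact Or.inr ⟨⟨(heq x hxN).symm.trans_ne hx, hxN⟩, hxT⟩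
  · rw [heq _ (hfT ⟨t, ht, rfl⟩).2]

namespace IsMultisetParam

variable {θ : Plane → ℕ} {f : ℝ → Plane} {T : Set ℝ} {ϑ : ℝ → ℝ≥0∞}

lemma lintegral_arclength (hp : IsMultisetParam θ f T ϑ) (G : Plane → ℝ≥0∞) :
    ∫⁻ x, G x ∂arclength θ = ∫⁻ t in T, ϑ t * (‖deriv f t‖ₑ * G (f t)) := by
  calc ∫⁻ x, G x ∂arclength θ
      = ∫⁻ x, θ x * G x ∂μH[1] :=
        lintegral_withDensity_eq_lintegral_mul_non_measurable₀ _
          (measurable_from_top.comp_aemeasurable hp.aemeasurable)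
          (Filter.Eventually.of_forall fun x => ENNReal.natCast_lt_top _) G
    _ = ∫⁻ x in f '' T, θ x * G x ∂μH[1] := by
        rw [← lintegral_indicator hp.isParam.measurableSet_image]
        refine lintegral_congr_ae ?_
        filter_upwards [measure_eq_zero_iff_ae_notMem.1 hp.hausdorffMeasure_sdiff] with x hx
        by_cases hxT : x ∈ f '' T
        · rw [indicator_of_mem hxT]
        · have hθ : θ x = 0 := of_not_not fun h => hx ⟨h, hxT⟩
          rw [indicator_of_notMem hxT, hθ, Nat.cast_zero, zero_mul]
    _ = ∫⁻ t in T, ‖deriv f t‖ₑ * (θ (f t) * G (f t)) := hp.isParam.setLIntegral_image _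
    _ = _ := setLIntegral_congr_fun hp.isParam.measurableSet fun t ht => by
        simp only [hp.eq_natCast t ht, mul_left_comm]

lemma ae_crossings_eq (hp : IsMultisetParam θ f T ϑ) (m : ℝ) :
    ∀ᵐ c, crossings θ m c = paramCrossings f T ϑ (m, c) := by
  filter_upwards [measure_eq_zero_iff_ae_notMem.1
    (volume_lineForm_image_eq_zero hp.hausdorffMeasure_sdiff m)] with c hc
  have hbij : BijOn f (T ∩ (fun t => lineForm m (f t)) ⁻¹' {c}) (f '' T ∩ lineForm m ⁻¹' {c}) := by
    refine ⟨fun t ht => ⟨⟨t, ht.1, rfl⟩, ht.2⟩, hp.isParam.injOn.mono inter_subset_left, ?_⟩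
    rintro _ ⟨⟨t, ht, rfl⟩, hx⟩
    exact ⟨t, ⟨ht, hx⟩, rfl⟩
  have himage : crossings θ m c = ∑' x, (f '' T ∩ lineForm m ⁻¹' {c}).indicator
      (fun x => (θ x : ℝ≥0∞)) x := by
    refine tsum_congr fun x => ?_
    by_cases hx : lineForm m x = c
    · by_cases hxT : x ∈ f '' T
      · rw [indicator_of_mem (show x ∈ univ ∩ lineForm m ⁻¹' {c} from ⟨mem_univ _, hx⟩),
          indicator_of_mem (show x ∈ f '' T ∩ lineForm m ⁻¹' {c} from ⟨hxT, hx⟩)]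
      · have hθ : θ x = 0 := of_not_not fun h => hc ⟨x, ⟨h, hxT⟩, hx⟩
        simp [indicator, hθ]
    · rw [indicator_of_notMem fun H => hx H.2, indicator_of_notMem fun H => hx H.2]
  rw [himage, paramCrossings, fiberSum, ← tsum_subtype, ← tsum_subtype, ← hbij.equiv.tsum_eq]
  exact tsum_congr fun t => (hp.eq_natCast t t.2.1).symm

lemma lintegral_energyKernel (hp : IsMultisetParam θ f T ϑ) :
    ∫⁻ x, ∫⁻ y, ENNReal.ofReal (energyKernel (unitNormal (Function.support θ)) x y)
        ∂arclength θ ∂arclength θ =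
      ∫⁻ t in T, ϑ t * ∫⁻ s in T, ϑ s * ENNReal.ofReal (paramKernel f t s) := by
  have hν := hp.isParam.isUnitNormalField_unitNormal hp.hausdorffMeasure_sdiff
  set ν := unitNormal (Function.support θ)
  have hnormal : ∀ᵐ t ∂volume.restrict T, inner ℝ (ν (f t)) (deriv f t) = 0 :=
    (ae_restrict_iff' hp.isParam.measurableSet).2 ((hp.isParam.normal _ _ hν).mono fun t h ht =>
      h ht (hp.image_subset ⟨t, ht, rfl⟩))
  simp_rw [hp.lintegral_arclength]
  refine lintegral_congr_ae ?_
  filter_upwards [hnormal] with t ht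
  rw [← lintegral_const_mul' _ _ enorm_ne_top]
  congr 1
  refine lintegral_congr_ae ?_
  filter_upwards [hnormal] with s hs
  rw [← energyKernel_mul_norm hν.1 ht hs, ENNReal.ofReal_mul (by positivity),
    ENNReal.ofReal_mul (by positivity), ofReal_norm, ofReal_norm]
  ring

end IsMultisetParam

section Crofton

variable {θ : Plane → ℕ}

theorem lineIntegral_crossings (hθ : AEMeasurable θ μH[1])
    (hr : IsRectifiable (Function.support θ)) :
    lineIntegral (crossings θ) = 2 * arclength θ univ := by
  obtain ⟨f, T, ϑ, hp⟩ := exists_isMultisetParam hθ hr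
  rw [lineIntegral_eq_lintegral (aemeasurable_paramCrossings hp.isParam hp.measurable)
    hp.ae_crossings_eq, lintegral_paramCrossings hp.isParam hp.measurable, ← lintegral_one,
    hp.lintegral_arclength, ← lintegral_const_mul' _ _ ENNReal.ofNat_ne_top]
  exact lintegral_congr fun t => by ring

/-- The quadratic Crofton formula. The diagonal term, where both points of a pair are the same,
splits into the length and the interaction of copies lying on top of each other, since
`θ² = θ + θ (θ - 1)`. -/
theorem lineIntegral_crossings_sq (hθ : AEMeasurable θ μH[1])
    (hr : IsRectifiable (Function.support θ)) :
    lineIntegral (fun m c => crossings θ m c ^ 2) = multisetEnergy θ + 2 * arclength θ univ := by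
  obtain ⟨f, T, ϑ, hp⟩ := exists_isMultisetParam hθ hr
  have : Measurable fun t => ‖deriv f t‖ₑ := (measurable_deriv f).enorm
  have hϑ := hp.measurable
  have hdiag : 2 * ∫⁻ x, ((θ x - 1 : ℕ) : ℝ≥0∞) ∂arclength θ + 2 * arclength θ univ =
      ∫⁻ t in T, ϑ t * (2 * ‖deriv f t‖ₑ * ϑ t) := by
    rw [← lintegral_one, ← mul_add, ← lintegral_add_right _ measurable_const,
      hp.lintegral_arclength, ← lintegral_const_mul' _ _ ENNReal.ofNat_ne_top]
    refine setLIntegral_congr_fun hp.isParam.measurableSet fun t ht => ?_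
    obtain ⟨k, hk⟩ := Nat.exists_eq_succ_of_ne_zero (hp.image_subset ⟨t, ht, rfl⟩)
    simp only [hp.eq_natCast t ht, hk, Nat.succ_sub_one, Nat.cast_succ]
    ring
  rw [lineIntegral_eq_lintegral
      ((aemeasurable_paramCrossings hp.isParam hϑ).pow_const 2)
      (fun m => (hp.ae_crossings_eq m).mono fun c hc => by rw [hc]),
    lintegral_paramCrossings_sq hp.isParam hϑ, multisetEnergy, add_assoc, hdiag,
    hp.lintegral_energyKernel, add_comm, ← lintegral_add_left (by fun_prop)]
  simp_rw [mul_add]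

end Crofton

/-! ### Crossings of sets with lines -/

lemma support_setMultiplicity (A : Set Plane) : Function.support (setMultiplicity A) = A := by
  ext x
  simp [setMultiplicity]

lemma crossings_eq_tsum (θ : Plane → ℕ) (m c : ℝ) :
    crossings θ m c = ∑' x : lineForm m ⁻¹' {c}, (θ x : ℝ≥0∞) := by
  rw [crossings, fiberSum, univ_inter, tsum_subtype (lineForm m ⁻¹' {c}) fun x => (θ x : ℝ≥0∞)]

lemma crossings_add (θ₁ θ₂ : Plane → ℕ) (m c : ℝ) :
    crossings (θ₁ + θ₂) m c = crossings θ₁ m c + crossings θ₂ m c := by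
  simp only [crossings_eq_tsum, ← ENNReal.tsum_add, Pi.add_apply, Nat.cast_add]

lemma crossings_nsmul (n : ℕ) (θ : Plane → ℕ) (m c : ℝ) :
    crossings (n • θ) m c = n * crossings θ m c := by
  simp only [crossings_eq_tsum, ← ENNReal.tsum_mul_left, Pi.smul_apply, smul_eq_mul, Nat.cast_mul]

lemma crossings_setMultiplicity (A : Set Plane) (m c : ℝ) :
    crossings (setMultiplicity A) m c = ((A ∩ lineForm m ⁻¹' {c}).encard : ℝ≥0∞) := by
  rw [← ENNReal.tsum_set_one, tsum_subtype (A ∩ lineForm m ⁻¹' {c}) fun _ => (1 : ℝ≥0∞),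
    inter_comm, ← indicator_indicator, ← tsum_subtype, crossings_eq_tsum]
  refine tsum_congr fun x => ?_
  by_cases hx : (x : Plane) ∈ A <;> simp [setMultiplicity, hx]

lemma crossings_eq_zero {θ : Plane → ℕ} {m c : ℝ} (h : c ∉ lineForm m '' Function.support θ) :
    crossings θ m c = 0 := by
  rw [crossings_eq_tsum, ENNReal.tsum_eq_zero]
  intro x
  have hx : θ x = 0 := of_not_not fun hx => h ⟨x, hx, x.2⟩
  rw [hx, Nat.cast_zero]

lemma tsum_natCast_eq_top_or_natCast {ι : Type*} (a : ι → ℕ) :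
    ∑' i, (a i : ℝ≥0∞) = ∞ ∨ ∃ k : ℕ, ∑' i, (a i : ℝ≥0∞) = k := by
  refine or_iff_not_imp_left.2 fun h => ?_
  have hfin := ENNReal.finite_const_le_of_tsum_ne_top h one_ne_zero
  refine ⟨∑ i ∈ hfin.toFinset, a i, ?_⟩
  rw [Nat.cast_sum, tsum_eq_sum]
  intro i hi
  rw [hfin.mem_toFinset, mem_ofPred_eq, Nat.one_le_cast, Nat.one_le_iff_ne_zero, not_not] at hi
  rw [hi, Nat.cast_zero]

lemma crossings_eq_top_or_natCast (θ : Plane → ℕ) (m c : ℝ) :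
    crossings θ m c = ∞ ∨ ∃ k : ℕ, crossings θ m c = k := by
  rw [crossings_eq_tsum]
  exact tsum_natCast_eq_top_or_natCast _

/-! ### Lines and convex sets -/

lemma exists_eq_Ioo {I : Set ℝ} (ho : IsOpen I) (hc : Convex ℝ I) (hb : Bornology.IsBounded I)
    (hne : I.Nonempty) : ∃ α β, α < β ∧ I = Ioo α β := by
  have hsub : I ⊆ Ioo (sInf I) (sSup I) := by
    rw [← interior_Icc]
    exact interior_maximal (subset_Icc_csInf_csSup hb.bddBelow hb.bddAbove) ho
  have hconn : IsConnected I := ⟨hne, hc.isPreconnected⟩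
  obtain ⟨x, hx⟩ := hne
  exact ⟨sInf I, sSup I, (hsub hx).1.trans (hsub hx).2,
    hsub.antisymm (hconn.Ioo_csInf_csSup_subset hb.bddBelow hb.bddAbove)⟩

section ConvexPreimage

variable {E F : Type*} [NormedAddCommGroup E] [NormedSpace ℝ E]
  [NormedAddCommGroup F] [NormedSpace ℝ F] {Ω : Set E}

lemma closure_preimage_of_isOpen_of_convex (ho : IsOpen Ω) (hc : Convex ℝ Ω) {g : F →ᵃ[ℝ] E}
    (hg : Continuous g) (hne : (g ⁻¹' Ω).Nonempty) : closure (g ⁻¹' Ω) = g ⁻¹' closure Ω := by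
  obtain ⟨s, hs⟩ := hne
  refine (hg.closure_preimage_subset Ω).antisymm fun t ht => ?_
  have hsub : openSegment ℝ s t ⊆ g ⁻¹' Ω := by
    rw [← image_subset_iff, image_openSegment]
    have := hc.openSegment_interior_closure_subset_interior (ho.interior_eq.symm ▸ hs) ht
    exact this.trans interior_subset
  exact closure_mono hsub (segment_subset_closure_openSegment (right_mem_segment ℝ s t))

lemma frontier_preimage_of_isOpen_of_convex (ho : IsOpen Ω) (hc : Convex ℝ Ω) {g : F →ᵃ[ℝ] E}
    (hg : Continuous g) (hne : (g ⁻¹' Ω).Nonempty) : frontier (g ⁻¹' Ω) = g ⁻¹' frontier Ω := by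
  rw [(ho.preimage hg).frontier_eq, ho.frontier_eq, preimage_sdiff,
    closure_preimage_of_isOpen_of_convex ho hc hg hne]

lemma encard_frontier_inter_range_lineMap (ho : IsOpen Ω) (hc : Convex ℝ Ω)
    (hb : Bornology.IsBounded Ω) {p q : E} (hp : p ∈ Ω) (hpq : p ≠ q) :
    (frontier Ω ∩ range (AffineMap.lineMap p q : ℝ →ᵃ[ℝ] E)).encard = 2 := by
  set g : ℝ →ᵃ[ℝ] E := AffineMap.lineMap p q
  have hg : Continuous g := AffineMap.lineMap_continuous
  have hgi : Function.Injective g := AffineMap.lineMap_injective ℝ hpq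
  have hne : (g ⁻¹' Ω).Nonempty := ⟨0, by rwa [mem_preimage, AffineMap.lineMap_apply_zero]⟩
  obtain ⟨α, β, hαβ, hI⟩ := exists_eq_Ioo (ho.preimage hg) (hc.affine_preimage g)
    ((antilipschitzWith_lineMap hpq).isBounded_preimage hb) hne
  rw [← encard_preimage_of_injective_subset_range hgi inter_subset_right, preimage_inter,
    preimage_range, inter_univ, ← frontier_preimage_of_isOpen_of_convex ho hc hg hne, hI,
    frontier_Ioo hαβ, encard_pair hαβ.ne]

lemma injOn_segment_of_apply_ne {f : E →ₗ[ℝ] F} {a b : E} (hab : f a ≠ f b) :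
    InjOn f (segment ℝ a b) := by
  rw [segment_eq_image_lineMap]
  rintro _ ⟨s, -, rfl⟩ _ ⟨t, -, rfl⟩ h
  rw [← f.coe_toAffineMap, AffineMap.apply_lineMap, AffineMap.apply_lineMap] at h
  rw [AffineMap.lineMap_injective ℝ hab h]

end ConvexPreimage

section LineFormConvex

variable {Ω : Set Plane}

lemma isOpen_lineForm_image (ho : IsOpen Ω) (m : ℝ) : IsOpen (lineForm m '' Ω) :=
  (lineForm m).isOpenMap (fun c => ⟨!₂[0, c], by simp [lineForm_apply]⟩) Ω ho

lemma ae_mem_lineForm_image (ho : IsOpen Ω) (hc : Convex ℝ Ω) (m : ℝ) :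
    ∀ᵐ c, c ∈ lineForm m '' closure Ω → c ∈ lineForm m '' Ω := by
  have himage : Convex ℝ (lineForm m '' Ω) := hc.linear_image (lineForm m).toLinearMap
  filter_upwards [measure_eq_zero_iff_ae_notMem.1 (himage.addHaar_frontier volume)] with c hc hcl
  rw [(isOpen_lineForm_image ho m).frontier_eq] at hc
  exact of_not_not fun h =>
    hc ⟨image_closure_subset_closure_image (lineForm m).continuous hcl, h⟩

lemma lineForm_preimage_singleton (m : ℝ) (p : Plane) :
    lineForm m ⁻¹' {lineForm m p} = range (AffineMap.lineMap p (p + !₂[1, m]) : ℝ →ᵃ[ℝ] Plane) := by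
  have hline : ∀ s : ℝ, lineForm m (AffineMap.lineMap p (p + !₂[1, m]) s) = lineForm m p := by
    have hdir : lineForm m !₂[1, m] = 0 := by simp [lineForm_apply]
    simp [AffineMap.lineMap_apply, hdir]
  refine Subset.antisymm (fun x hx => ⟨x 0 - p 0, ?_⟩) (range_subset_iff.2 hline)
  refine eq_of_lineForm_eq ((hline _).trans (Eq.symm hx)) ?_
  simp [AffineMap.lineMap_apply]

lemma encard_frontier_inter_line (ho : IsOpen Ω) (hc : Convex ℝ Ω) (hb : Bornology.IsBounded Ω)
    {p : Plane} (hp : p ∈ Ω) (m : ℝ) :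
    (frontier Ω ∩ lineForm m ⁻¹' {lineForm m p}).encard = 2 := by
  rw [lineForm_preimage_singleton]
  refine encard_frontier_inter_range_lineMap ho hc hb hp fun h => ?_
  simpa using congrArg (fun x : Plane => x 0) h

open Classical in
lemma ae_crossings_frontier (ho : IsOpen Ω) (hc : Convex ℝ Ω) (hb : Bornology.IsBounded Ω)
    (m : ℝ) : ∀ᵐ c, crossings (setMultiplicity (frontier Ω)) m c =
      if c ∈ lineForm m '' Ω then 2 else 0 := by
  filter_upwards [ae_mem_lineForm_image ho hc m] with c hmeet
  split_ifs with hcΩ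
  · obtain ⟨p, hp, rfl⟩ := hcΩ
    rw [crossings_setMultiplicity, encard_frontier_inter_line ho hc hb hp, ENat.toENNReal_ofNat]
  · refine crossings_eq_zero fun hfr => hcΩ (hmeet (image_mono ?_ hfr))
    rw [support_setMultiplicity]
    exact frontier_subset_closure

end LineFormConvex

lemma ae_lineForm_ne {a b : Plane} (hab : a ≠ b) : ∀ᵐ m, lineForm m a ≠ lineForm m b := by
  have hsub : {m | lineForm m a = lineForm m b}.Subsingleton := by
    intro m hm k hk
    have h0 : a 0 ≠ b 0 := fun h0 => hab (eq_of_lineForm_eq hm h0)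
    exact ((lineForm_eq_lineForm_iff_div_eq h0 m).1 hm).symm.trans
      ((lineForm_eq_lineForm_iff_div_eq h0 k).1 hk)
  exact measure_eq_zero_iff_ae_notMem.1 (hsub.measure_zero volume)

lemma ae_crossings_segment (a b : Plane) : ∀ᵐ m : ℝ, ∀ c,
    crossings (setMultiplicity (segment ℝ a b)) m c ≤ 1 := by
  have hinj : ∀ᵐ m, InjOn (lineForm m) (segment ℝ a b) := by
    rcases eq_or_ne a b with rfl | hab
    · exact Filter.Eventually.of_forall fun m => by
        rw [segment_same]
        exact injOn_singleton _ _
    · filter_upwards [ae_lineForm_ne hab] with m hm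
      exact injOn_segment_of_apply_ne (f := (lineForm m).toLinearMap) hm
  filter_upwards [hinj] with m hm c
  have hle : (segment ℝ a b ∩ lineForm m ⁻¹' {c}).encard ≤ 1 :=
    encard_le_one_iff.2 fun x y hx hy => hm hx.1 hy.1 (hx.2.trans (Eq.symm hy.2))
  rw [crossings_setMultiplicity]
  exact_mod_cast hle

/-! ### Rectifiability of segments and of boundaries of convex sets -/

lemma IsRectifiable.of_subset_range {A : Set Plane} {γ : ℝ → Plane} {C : ℝ≥0}
    (hγ : LipschitzWith C γ) (h : A ⊆ range γ) : IsRectifiable A := by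
  refine ⟨fun _ => γ, fun _ => ⟨C, hγ⟩, ?_⟩
  rw [iUnion_const, sdiff_eq_empty.2 h, measure_empty]

lemma IsRectifiable.iUnion {ι : Type*} [Countable ι] {A : ι → Set Plane}
    (hA : ∀ i, IsRectifiable (A i)) : IsRectifiable (⋃ i, A i) := by
  rcases isEmpty_or_nonempty ι with h | h
  · rw [iUnion_of_empty]
    exact .of_subset_range (LipschitzWith.const (0 : Plane)) (empty_subset _)
  obtain ⟨e, he⟩ := exists_surjective_nat ι
  choose γ hγ hnull using hA
  refine ⟨fun k => γ (e k.unpair.1) k.unpair.2, fun k => hγ _ _,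
    measure_mono_null ?_ (measure_iUnion_null hnull)⟩
  have hrange : ∀ i, ⋃ j, range (γ i j) ⊆ ⋃ k : ℕ, range (γ (e k.unpair.1) k.unpair.2) := by
    refine fun i => iUnion_subset fun j => ?_
    obtain ⟨k, rfl⟩ := he i
    refine subset_iUnion_of_subset (Nat.pair k j) ?_
    rw [Nat.unpair_pair]
  rw [iUnion_sdiff]
  exact iUnion_mono fun i => sdiff_subset_sdiff_right (hrange i)

lemma IsRectifiable.union {A B : Set Plane} (hA : IsRectifiable A) (hB : IsRectifiable B) :
    IsRectifiable (A ∪ B) := by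
  rw [union_eq_iUnion]
  exact .iUnion fun b => by cases b <;> assumption

lemma isRectifiable_segment (a b : Plane) : IsRectifiable (segment ℝ a b) := by
  refine .of_subset_range (lipschitzWith_lineMap (𝕜 := ℝ) a b) ?_
  rw [segment_eq_image_lineMap]
  exact image_subset_range _ _

section Projection

variable {E : Type*} [NormedAddCommGroup E] [InnerProductSpace ℝ E]

lemma norm_sub_le_norm_sub_of_inner_nonpos {x y p q : E} (hx : inner ℝ (x - p) (q - p) ≤ 0)
    (hy : inner ℝ (y - q) (p - q) ≤ 0) : ‖p - q‖ ≤ ‖x - y‖ := by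
  have hsplit : x - y = (x - p) + (p - q) - (y - q) := by abel
  have hinner : ‖p - q‖ * ‖p - q‖ ≤ inner ℝ (x - y) (p - q) := by
    rw [← neg_sub p q, inner_neg_right] at hx
    rw [hsplit, inner_sub_left, inner_add_left, real_inner_self_eq_norm_mul_norm]
    linarith
  rcases (norm_nonneg (p - q)).eq_or_lt with h0 | h0
  · rw [← h0]
    exact norm_nonneg _
  · exact le_of_mul_le_mul_right (hinner.trans (real_inner_le_norm _ _)) h0

/-- The projection is the nearest-point map; obtuse angles at `p` characterize `p` as the nearest
point. -/
theorem exists_lipschitzWith_projection {K : Set E} (hne : K.Nonempty) (hK : IsComplete K)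
    (hc : Convex ℝ K) : ∃ π : E → E, LipschitzWith 1 π ∧
      ∀ z, ∀ p ∈ K, (∀ w ∈ K, inner ℝ (z - p) (w - p) ≤ 0) → π z = p := by
  have hex : ∀ z, ∃ p ∈ K, ∀ w ∈ K, inner ℝ (z - p) (w - p) ≤ 0 := fun z => by
    obtain ⟨p, hp, h⟩ := exists_norm_eq_iInf_of_complete_convex hne hK hc z
    exact ⟨p, hp, (norm_eq_iInf_iff_real_inner_le_zero hc hp).1 h⟩
  choose π hπK hπ using hex
  refine ⟨π, LipschitzWith.of_dist_le_mul fun x y => ?_, fun z p hp h => ?_⟩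
  · rw [NNReal.coe_one, one_mul, dist_eq_norm, dist_eq_norm]
    exact norm_sub_le_norm_sub_of_inner_nonpos (hπ x _ (hπK y)) (hπ y _ (hπK x))
  · have hle := norm_sub_le_norm_sub_of_inner_nonpos (hπ z p hp) (h _ (hπK z))
    rwa [sub_self, norm_zero, norm_le_zero_iff, sub_eq_zero] at hle

lemma exists_inner_sub_nonpos_of_mem_frontier [CompleteSpace E] {Ω : Set E} (hne : Ω.Nonempty)
    (ho : IsOpen Ω) (hc : Convex ℝ Ω) {p : E} (hp : p ∈ frontier Ω) :
    ∃ u ≠ 0, ∀ w ∈ closure Ω, inner ℝ u (w - p) ≤ 0 := by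
  rw [ho.frontier_eq] at hp
  obtain ⟨l, hl⟩ := geometric_hahn_banach_open_point hc ho hp.2
  obtain ⟨u, rfl⟩ := (InnerProductSpace.toDual ℝ E).surjective l
  simp only [InnerProductSpace.toDual_apply_apply] at hl
  refine ⟨u, ?_, fun w hw => ?_⟩
  · rintro rfl
    obtain ⟨x, hx⟩ := hne
    simpa using hl x hx
  · rw [inner_sub_right, sub_nonpos]
    exact closure_minimal (fun x hx => (hl x hx).le)
      (isClosed_le (f := fun x => inner ℝ u x) (by fun_prop) continuous_const) hw

lemma exists_nonneg_norm_add_smul_eq {p u : E} {R : ℝ} (hp : ‖p‖ ≤ R) (hu : u ≠ 0) :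
    ∃ t : ℝ, 0 ≤ t ∧ ‖p + t • u‖ = R := by
  have hR : 0 ≤ R := (norm_nonneg p).trans hp
  set τ := (R + ‖p‖) / ‖u‖
  have hτ : 0 ≤ τ := by positivity
  have hend : R ≤ ‖p + τ • u‖ := by
    have htri := norm_sub_le (p + τ • u) p
    rw [add_sub_cancel_left, norm_smul, Real.norm_of_nonneg hτ,
      div_mul_cancel₀ _ (norm_ne_zero_iff.2 hu)] at htri
    linarith
  have hcont : Continuous fun t : ℝ => ‖p + t • u‖ := by fun_prop
  obtain ⟨t, ht, h⟩ := intermediate_value_Icc hτ hcont.continuousOn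
    ⟨by rwa [zero_smul, add_zero], hend⟩
  exact ⟨t, ht.1, h⟩

theorem exists_lipschitzWith_frontier_subset_image_sphere [CompleteSpace E] {Ω : Set E}
    (hne : Ω.Nonempty) (ho : IsOpen Ω) (hc : Convex ℝ Ω) {R : ℝ} (hR : ∀ x ∈ closure Ω, ‖x‖ ≤ R) :
    ∃ π : E → E, LipschitzWith 1 π ∧ frontier Ω ⊆ π '' Metric.sphere 0 R := by
  obtain ⟨π, hπ, hproj⟩ :=
    exists_lipschitzWith_projection hne.closure isClosed_closure.isComplete hc.closure
  refine ⟨π, hπ, fun p hp => ?_⟩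
  have hpcl : p ∈ closure Ω := frontier_subset_closure hp
  obtain ⟨u, hu, hsupport⟩ := exists_inner_sub_nonpos_of_mem_frontier hne ho hc hp
  obtain ⟨t, ht, hnorm⟩ := exists_nonneg_norm_add_smul_eq (hR p hpcl) hu
  refine ⟨p + t • u, mem_sphere_zero_iff_norm.2 hnorm, hproj _ p hpcl fun w hw => ?_⟩
  rw [add_sub_cancel_left, real_inner_smul_left]
  exact mul_nonpos_of_nonneg_of_nonpos ht (hsupport w hw)

end Projection

lemma exists_lipschitzWith_sphere_subset_image {R : ℝ} (hR : 0 ≤ R) :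
    ∃ (γ : ℝ → Plane) (C : ℝ≥0), LipschitzWith C γ ∧
      Metric.sphere 0 R ⊆ γ '' Icc 0 (2 * Real.pi) := by
  set e := Complex.orthonormalBasisOneI.repr
  refine ⟨e ∘ circleMap 0 R, _, e.lipschitz.comp (lipschitzWith_circleMap 0 R), fun z hz => ?_⟩
  have hez : e.symm z ∈ Metric.sphere 0 |R| := by
    rw [mem_sphere_zero_iff_norm, e.symm.norm_map, abs_of_nonneg hR]
    exact mem_sphere_zero_iff_norm.1 hz
  rw [← image_circleMap_Ioc] at hez
  obtain ⟨t, ht, hzt⟩ := hez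
  exact ⟨t, Ioc_subset_Icc_self ht, by rw [Function.comp_apply, hzt, e.apply_symm_apply]⟩

/-- A nonempty bounded open convex set: the domain of the theorem, without regularity of the
boundary. -/
structure IsConvexDomain (Ω : Set Plane) : Prop where
  nonempty : Ω.Nonempty
  isOpen : IsOpen Ω
  isBounded : Bornology.IsBounded Ω
  convex : Convex ℝ Ω

namespace IsConvexDomain

variable {Ω : Set Plane}

/-- The boundary is the nearest-point projection of a large circle. -/
lemma exists_lipschitzWith_frontier_subset_image (hΩ : IsConvexDomain Ω) :
    ∃ (γ : ℝ → Plane) (C : ℝ≥0) (I : Set ℝ), LipschitzWith C γ ∧ volume I ≠ ∞ ∧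
      frontier Ω ⊆ γ '' I := by
  obtain ⟨R, hR⟩ := hΩ.isBounded.closure.exists_norm_le
  obtain ⟨x, hx⟩ := hΩ.nonempty.closure
  obtain ⟨γ, C, hγ, hsphere⟩ :=
    exists_lipschitzWith_sphere_subset_image ((norm_nonneg x).trans (hR x hx))
  obtain ⟨π, hπ, hfrontier⟩ := exists_lipschitzWith_frontier_subset_image_sphere
    hΩ.nonempty hΩ.isOpen hΩ.convex hR
  refine ⟨π ∘ γ, _, Icc 0 (2 * Real.pi), hπ.comp hγ, measure_Icc_lt_top.ne, hfrontier.trans ?_⟩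
  rw [image_comp]
  exact image_mono hsphere

lemma isRectifiable_frontier (hΩ : IsConvexDomain Ω) : IsRectifiable (frontier Ω) := by
  obtain ⟨γ, C, I, hγ, -, hsub⟩ := hΩ.exists_lipschitzWith_frontier_subset_image
  exact .of_subset_range hγ (hsub.trans (image_subset_range _ _))

lemma hausdorffMeasure_frontier_ne_top (hΩ : IsConvexDomain Ω) : μH[1] (frontier Ω) ≠ ∞ := by
  obtain ⟨γ, C, I, hγ, hI, hsub⟩ := hΩ.exists_lipschitzWith_frontier_subset_image
  refine ne_top_of_le_ne_top ?_
    ((measure_mono hsub).trans (hγ.hausdorffMeasure_image_le zero_le_one I))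
  rw [hausdorffMeasure_real]
  finiteness

lemma ofReal_perimeter (hΩ : IsConvexDomain Ω) :
    ENNReal.ofReal (perimeter Ω) = μH[1] (frontier Ω) :=
  ENNReal.ofReal_toReal hΩ.hausdorffMeasure_frontier_ne_top

end IsConvexDomain

/-! ### The lower bound for the energy -/

section LineIntegral

variable {F G : ℝ → ℝ → ℝ≥0∞} {k : ℝ≥0∞} {θ : Plane → ℕ} {A : Set Plane}

lemma lineIntegral_mono (h : ∀ᵐ m, ∀ᵐ c, F m c ≤ G m c) : lineIntegral F ≤ lineIntegral G := by
  refine lintegral_mono_ae ?_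
  filter_upwards [h] with m hm
  gcongr 1
  exact lintegral_mono_ae hm

lemma lineIntegral_congr (h : ∀ᵐ m, ∀ᵐ c, F m c = G m c) : lineIntegral F = lineIntegral G :=
  le_antisymm (lineIntegral_mono (h.mono fun _ hm => hm.mono fun _ => le_of_eq))
    (lineIntegral_mono (h.mono fun _ hm => hm.mono fun _ => ge_of_eq))

lemma lineIntegral_const_mul (hk : k ≠ ∞) (F : ℝ → ℝ → ℝ≥0∞) :
    lineIntegral (fun m c => k * F m c) = k * lineIntegral F := by
  unfold lineIntegral
  rw [← lintegral_const_mul' _ _ hk]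
  refine lintegral_congr fun m => ?_
  rw [lintegral_const_mul' _ _ hk]
  ring

lemma lineIntegral_add_right (F : ℝ → ℝ → ℝ≥0∞) {H : ℝ × ℝ → ℝ≥0∞} (hH : Measurable H) :
    lineIntegral (fun m c => F m c + H (m, c)) =
      lineIntegral F + lineIntegral fun m c => H (m, c) := by
  refine (lintegral_congr fun m => ?_).trans (lintegral_add_right _
    (measurable_lineDensity.ennreal_ofReal.mul hH.lintegral_prod_right'))
  rw [← mul_add]
  congr 1
  exact lintegral_add_right _ (hH.comp measurable_prodMk_left)

lemma exists_measurable_crossings (hθ : AEMeasurable θ μH[1])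
    (hr : IsRectifiable (Function.support θ)) :
    ∃ H : ℝ × ℝ → ℝ≥0∞, Measurable H ∧ ∀ᵐ m, ∀ᵐ c, crossings θ m c = H (m, c) := by
  obtain ⟨f, T, ϑ, hp⟩ := exists_isMultisetParam hθ hr
  obtain ⟨H, hH, hae⟩ := aemeasurable_paramCrossings hp.isParam hp.measurable
  refine ⟨H, hH, ?_⟩
  rw [Measure.volume_eq_prod] at hae
  filter_upwards [Measure.ae_ae_of_ae_prod hae] with m hm
  filter_upwards [hm, hp.ae_crossings_eq m] with c hparam hcross
  rw [hcross, hparam]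

lemma lineIntegral_add_mul_crossings (F : ℝ → ℝ → ℝ≥0∞) (hk : k ≠ ∞) (hθ : AEMeasurable θ μH[1])
    (hr : IsRectifiable (Function.support θ)) :
    lineIntegral (fun m c => F m c + k * crossings θ m c) =
      lineIntegral F + k * (2 * arclength θ univ) := by
  obtain ⟨H, hH, hae⟩ := exists_measurable_crossings hθ hr
  calc lineIntegral (fun m c => F m c + k * crossings θ m c)
      = lineIntegral (fun m c => F m c + k * H (m, c)) := lineIntegral_congr <| by
        filter_upwards [hae] with m hm
        filter_upwards [hm] with c hc
        rw [hc]
    _ = lineIntegral F + k * lineIntegral fun m c => H (m, c) := by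
        rw [lineIntegral_add_right F (hH.const_mul k), lineIntegral_const_mul hk]
    _ = _ := by rw [← lineIntegral_congr hae, lineIntegral_crossings hθ hr]

lemma aemeasurable_setMultiplicity (hA : NullMeasurableSet A μH[1]) :
    AEMeasurable (setMultiplicity A) μH[1] :=
  aemeasurable_one.indicator₀ hA

lemma arclength_setMultiplicity_univ (hA : NullMeasurableSet A μH[1]) :
    arclength (setMultiplicity A) univ = μH[1] A := by
  rw [arclength_setMultiplicity hA, Measure.restrict_apply_univ]

lemma lineIntegral_crossings_sq_add_mul (hk : k ≠ ∞) (hθ : AEMeasurable θ μH[1])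
    (hr : IsRectifiable (Function.support θ)) (hA : NullMeasurableSet A μH[1])
    (hAr : IsRectifiable A) :
    lineIntegral (fun m c => crossings θ m c ^ 2 + k * crossings (setMultiplicity A) m c) =
      multisetEnergy θ + 2 * arclength θ univ + k * (2 * μH[1] A) := by
  rw [lineIntegral_add_mul_crossings _ hk (aemeasurable_setMultiplicity hA)
    (by rwa [support_setMultiplicity]), arclength_setMultiplicity_univ hA,
    lineIntegral_crossings_sq hθ hr]

end LineIntegral

/-- This is `0 ≤ (N - 2 * n) * (N - (2 * n + 1))`: no integer lies strictly between consecutive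
ones. -/
lemma mul_le_sq_add (n : ℕ) {N : ℝ≥0∞} (hN : N = ∞ ∨ ∃ k : ℕ, N = k) :
    (4 * n + 1) * N ≤ N ^ 2 + n * (2 * n + 1) * 2 := by
  rcases hN with rfl | ⟨k, rfl⟩
  · simp
  · norm_cast
    zify
    have hprod : (0 : ℤ) ≤ (k - 2 * n) * (k - (2 * n + 1)) := by
      rcases le_or_gt (k : ℤ) (2 * n) with h | h
      · exact mul_nonneg_of_nonpos_of_nonpos (by lia) (by lia)
      · exact mul_nonneg (by lia) (by lia)
    linarith

lemma isClosed_segment {E : Type*} [AddCommGroup E] [Module ℝ E] [TopologicalSpace E]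
    [IsTopologicalAddGroup E] [ContinuousSMul ℝ E] [T2Space E] (a b : E) :
    IsClosed (segment ℝ a b) := by
  rw [segment_eq_image_lineMap]
  exact (isCompact_Icc.image AffineMap.lineMap_continuous).isClosed

lemma nullMeasurableSet_frontier (Ω : Set Plane) : NullMeasurableSet (frontier Ω) μH[1] :=
  isClosed_frontier.measurableSet.nullMeasurableSet

lemma nullMeasurableSet_segment (a b : Plane) : NullMeasurableSet (segment ℝ a b) μH[1] :=
  (isClosed_segment a b).measurableSet.nullMeasurableSet

lemma crossings_boundaryCopiesAndSegment (Ω : Set Plane) (n : ℕ) (a b : Plane) (m c : ℝ) :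
    crossings (boundaryCopiesAndSegment Ω n a b) m c =
      n * crossings (setMultiplicity (frontier Ω)) m c +
        crossings (setMultiplicity (segment ℝ a b)) m c := by
  rw [boundaryCopiesAndSegment, crossings_add, crossings_nsmul]

lemma aemeasurable_boundaryCopiesAndSegment (Ω : Set Plane) (n : ℕ) (a b : Plane) :
    AEMeasurable (boundaryCopiesAndSegment Ω n a b) μH[1] :=
  ((aemeasurable_setMultiplicity (nullMeasurableSet_frontier Ω)).const_smul n).add
    (aemeasurable_setMultiplicity (nullMeasurableSet_segment a b))

lemma support_boundaryCopiesAndSegment_subset (Ω : Set Plane) (n : ℕ) (a b : Plane) :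
    Function.support (boundaryCopiesAndSegment Ω n a b) ⊆ frontier Ω ∪ segment ℝ a b := by
  rw [← support_setMultiplicity (frontier Ω), ← support_setMultiplicity (segment ℝ a b)]
  exact (Function.support_add _ _).trans
    (union_subset_union_left _ (Function.support_const_smul_subset n _))

lemma arclength_boundaryCopiesAndSegment (Ω : Set Plane) (n : ℕ) (a b : Plane) :
    arclength (boundaryCopiesAndSegment Ω n a b) univ =
      n * μH[1] (frontier Ω) + edist a b := by
  have hf : MeasurableSet (frontier Ω) := isClosed_frontier.measurableSet
  have hs : MeasurableSet (segment ℝ a b) := (isClosed_segment a b).measurableSet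
  have hcast : ∀ x, (boundaryCopiesAndSegment Ω n a b x : ℝ≥0∞) =
      n * (frontier Ω).indicator 1 x + (segment ℝ a b).indicator 1 x := by
    intro x
    by_cases hxf : x ∈ frontier Ω <;> by_cases hxs : x ∈ segment ℝ a b <;>
      simp [boundaryCopiesAndSegment, setMultiplicity, hxf, hxs]
  rw [arclength, withDensity_apply _ MeasurableSet.univ, Measure.restrict_univ]
  simp_rw [hcast]
  rw [lintegral_add_right _ (measurable_one.indicator hs),
    lintegral_const_mul _ (measurable_one.indicator hf), lintegral_indicator_one hf,
    lintegral_indicator_one hs, hausdorffMeasure_segment]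

namespace IsConvexDomain

variable {Ω : Set Plane} {a b : Plane} {L : ℝ}

theorem le_multisetEnergy_add (hΩ : IsConvexDomain Ω) (n : ℕ) {θ : Plane → ℕ}
    (hθ : IsRectifiableMultisetIn Ω L θ) :
    (4 * n + 1) * (2 * ENNReal.ofReal L) ≤ multisetEnergy θ + 2 * ENNReal.ofReal L +
      n * (2 * n + 1) * (2 * μH[1] (frontier Ω)) := by
  rw [← hθ.length_eq, ← lineIntegral_crossings hθ.measurable hθ.rectifiable,
    ← lineIntegral_const_mul (by finiteness), lineIntegral_crossings hθ.measurable hθ.rectifiable,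
    ← lineIntegral_crossings_sq_add_mul (by finiteness) hθ.measurable hθ.rectifiable
      (nullMeasurableSet_frontier Ω) hΩ.isRectifiable_frontier]
  refine lineIntegral_mono (Filter.Eventually.of_forall fun m => ?_)
  filter_upwards [ae_crossings_frontier hΩ.isOpen hΩ.convex hΩ.isBounded m,
    ae_mem_lineForm_image hΩ.isOpen hΩ.convex m] with c hfrontier hmeet
  rw [hfrontier]
  split_ifs with hc
  · exact mul_le_sq_add n (crossings_eq_top_or_natCast θ m c)
  · rw [crossings_eq_zero fun hsupp => hc (hmeet (image_mono hθ.subset hsupp)), mul_zero]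
    exact zero_le

lemma ae_crossings_segment (hΩ : IsConvexDomain Ω) (hab : segment ℝ a b ⊆ closure Ω) :
    ∀ᵐ m, ∀ᵐ c, crossings (setMultiplicity (segment ℝ a b)) m c = 0 ∨
      c ∈ lineForm m '' Ω ∧ crossings (setMultiplicity (segment ℝ a b)) m c = 1 := by
  filter_upwards [_root_.ae_crossings_segment a b] with m hle
  filter_upwards [ae_mem_lineForm_image hΩ.isOpen hΩ.convex m] with c hmeet
  refine or_iff_not_imp_left.2 fun hne => ⟨hmeet ?_, (hle c).antisymm ?_⟩
  · have hsupp := not_imp_comm.1 crossings_eq_zero hne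
    rw [support_setMultiplicity] at hsupp
    exact image_mono hab hsupp
  · rcases crossings_eq_top_or_natCast (setMultiplicity (segment ℝ a b)) m c with h | ⟨k, h⟩
    · rw [h]
      exact le_top
    · rw [h] at hne ⊢
      exact_mod_cast Nat.one_le_iff_ne_zero.2 fun h0 => hne (by rw [h0, Nat.cast_zero])

lemma ae_crossings_boundaryCopiesAndSegment (hΩ : IsConvexDomain Ω)
    (hab : segment ℝ a b ⊆ closure Ω) (n : ℕ) : ∀ᵐ m, ∀ᵐ c,
    (c ∈ lineForm m '' Ω ∧ (crossings (boundaryCopiesAndSegment Ω n a b) m c = 2 * n ∨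
        crossings (boundaryCopiesAndSegment Ω n a b) m c = 2 * n + 1)) ∨
      c ∉ lineForm m '' Ω ∧ crossings (boundaryCopiesAndSegment Ω n a b) m c = 0 := by
  filter_upwards [hΩ.ae_crossings_segment hab] with m hm
  filter_upwards [hm, ae_crossings_frontier hΩ.isOpen hΩ.convex hΩ.isBounded m]
    with c hsegment hfrontier
  rw [crossings_boundaryCopiesAndSegment, hfrontier]
  split_ifs with hc
  · rw [mul_comm]
    rcases hsegment with h | ⟨-, h⟩ <;> simp [hc, h]
  · rw [hsegment.resolve_right fun h => hc h.1, mul_zero, add_zero]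
    exact .inr ⟨hc, rfl⟩

lemma isRectifiableMultisetIn_boundaryCopiesAndSegment (hΩ : IsConvexDomain Ω)
    (hab : segment ℝ a b ⊆ closure Ω) {n : ℕ} (hL : dist a b = L - n * perimeter Ω) :
    IsRectifiableMultisetIn Ω L (boundaryCopiesAndSegment Ω n a b) := by
  have hsub := support_boundaryCopiesAndSegment_subset Ω n a b
  have hperimeter : 0 ≤ perimeter Ω := ENNReal.toReal_nonneg
  refine ⟨hsub.trans (union_subset frontier_subset_closure hab),
    aemeasurable_boundaryCopiesAndSegment Ω n a b,
    (hΩ.isRectifiable_frontier.union (isRectifiable_segment a b)).mono hsub, ?_⟩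
  rw [arclength_boundaryCopiesAndSegment, ← hΩ.ofReal_perimeter, edist_dist,
    ← ENNReal.ofReal_natCast, ← ENNReal.ofReal_mul n.cast_nonneg,
    ← ENNReal.ofReal_add (by positivity) dist_nonneg, hL, add_sub_cancel]

theorem multisetEnergy_boundaryCopiesAndSegment_add (hΩ : IsConvexDomain Ω)
    (hab : segment ℝ a b ⊆ closure Ω) {n : ℕ} (hL : dist a b = L - n * perimeter Ω) :
    multisetEnergy (boundaryCopiesAndSegment Ω n a b) + 2 * ENNReal.ofReal L +
      n * (2 * n + 1) * (2 * μH[1] (frontier Ω)) = (4 * n + 1) * (2 * ENNReal.ofReal L) := by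
  have hθ := hΩ.isRectifiableMultisetIn_boundaryCopiesAndSegment hab hL
  rw [← hθ.length_eq, ← lineIntegral_crossings_sq_add_mul (by finiteness) hθ.measurable
    hθ.rectifiable (nullMeasurableSet_frontier Ω) hΩ.isRectifiable_frontier,
    ← lineIntegral_crossings hθ.measurable hθ.rectifiable,
    ← lineIntegral_const_mul (by finiteness)]
  refine lineIntegral_congr ?_
  filter_upwards [hΩ.ae_crossings_boundaryCopiesAndSegment hab n] with m hm
  filter_upwards [hm, ae_crossings_frontier hΩ.isOpen hΩ.convex hΩ.isBounded m]
    with c hcross hfrontier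
  rw [hfrontier]
  rcases hcross with ⟨hc, h | h⟩ | ⟨hc, h⟩
  · rw [h, if_pos hc]
    ring
  · rw [h, if_pos hc]
    ring
  · rw [h, if_neg hc]
    ring

theorem multisetEnergy_boundaryCopiesAndSegment_le (hΩ : IsConvexDomain Ω)
    (hab : segment ℝ a b ⊆ closure Ω) {n : ℕ} (hL : dist a b = L - n * perimeter Ω)
    {θ : Plane → ℕ} (hθ : IsRectifiableMultisetIn Ω L θ) :
    multisetEnergy (boundaryCopiesAndSegment Ω n a b) ≤ multisetEnergy θ := by
  have hle := hΩ.le_multisetEnergy_add n hθ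
  have hfin := hΩ.hausdorffMeasure_frontier_ne_top
  rwa [← hΩ.multisetEnergy_boundaryCopiesAndSegment_add hab hL,
    ENNReal.add_le_add_iff_right (by finiteness),
    ENNReal.add_le_add_iff_right (by finiteness)] at hle

end IsConvexDomain

/-! ### Approximation by sets without multiplicity -/

lemma not_countable_Ioo {α β : ℝ} (hαβ : α < β) : ¬(Ioo α β).Countable := by
  intro h
  have hvol := h.measure_zero volume
  rw [Real.volume_Ioo, ENNReal.ofReal_eq_zero] at hvol
  linarith

lemma infinite_setOf_measure_inter_eq_zero {ι X : Type*} [MeasurableSpace X] {μ : Measure X}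
    {I : Set ι} (hI : ¬I.Countable) {s : ι → Set X} (hs : ∀ i ∈ I, MeasurableSet (s i))
    (hd : I.PairwiseDisjoint s) {B : Set X} (hB : μ B ≠ ∞) :
    {i ∈ I | μ (s i ∩ B) = 0}.Infinite := by
  have hcount : {i : I | 0 < μ.restrict B (s i)}.Countable :=
    Measure.countable_meas_pos_of_disjoint_of_meas_iUnion_ne_top (μ.restrict B)
      (fun i => hs i i.2) (fun i j hij => hd i.2 j.2 (Subtype.coe_ne_coe.2 hij))
      (ne_top_of_le_ne_top hB (Measure.restrict_apply_univ (μ := μ) B ▸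
        measure_mono (subset_univ _)))
  intro hfinite
  refine hI ((hfinite.countable.union (hcount.image Subtype.val)).mono fun i hi => ?_)
  by_cases h : μ (s i ∩ B) = 0
  · exact Or.inl ⟨hi, h⟩
  · refine Or.inr ⟨⟨i, hi⟩, ?_, rfl⟩
    rw [mem_ofPred_eq, Measure.restrict_apply (hs i hi)]
    exact pos_iff_ne_zero.2 h

section Homothety

variable {E : Type*} [NormedAddCommGroup E] [NormedSpace ℝ E] {Ω : Set E} {o : E} {r : ℝ}

lemma homothety_mem_of_mem_closure (ho : IsOpen Ω) (hc : Convex ℝ Ω) (hoΩ : o ∈ Ω)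
    (hr : r ∈ Ioo (0 : ℝ) 1) {p : E} (hp : p ∈ closure Ω) : AffineMap.homothety o r p ∈ Ω := by
  have hsegment := hc.openSegment_interior_closure_subset_interior (ho.interior_eq.symm ▸ hoΩ) hp
  rw [ho.interior_eq, openSegment_eq_image_lineMap] at hsegment
  exact hsegment ⟨r, hr, rfl⟩

lemma homothety_image_closure_subset (ho : IsOpen Ω) (hc : Convex ℝ Ω) (hoΩ : o ∈ Ω)
    (hr : r ∈ Ioo (0 : ℝ) 1) : AffineMap.homothety o r '' closure Ω ⊆ Ω :=
  image_subset_iff.2 fun _ hp => homothety_mem_of_mem_closure ho hc hoΩ hr hp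

lemma frontier_homothety_image (Ω : Set E) (o : E) (hr : r ≠ 0) :
    frontier (AffineMap.homothety o r '' Ω) = AffineMap.homothety o r '' frontier Ω :=
  let e : E ≃ₜ E := (AffineEquiv.homothetyUnitsMulHom o
    (Units.mk0 r hr)).toEquiv.toHomeomorphOfContinuousOpen
    (AffineMap.homothety_continuous o r) (AffineMap.homothety_isOpenMap o r hr)
  (e.image_frontier Ω).symm

/-- Shrinking `∂Ω` by the ratio of the two factors moves it into the open set `Ω`. -/
lemma disjoint_homothety_image_frontier (ho : IsOpen Ω) (hc : Convex ℝ Ω) (hoΩ : o ∈ Ω)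
    {s : ℝ} (hr : 0 < r) (hrs : r < s) :
    Disjoint (AffineMap.homothety o r '' frontier Ω) (AffineMap.homothety o s '' frontier Ω) := by
  have hs : 0 < s := hr.trans hrs
  rw [Set.disjoint_left]
  rintro _ ⟨p, hp, rfl⟩ ⟨q, hq, hpq⟩
  have hshrink : AffineMap.homothety o (s⁻¹ * r) p = q := by
    rw [AffineMap.homothety_mul_apply, ← hpq, ← AffineMap.homothety_mul_apply,
      inv_mul_cancel₀ hs.ne', AffineMap.homothety_one, AffineMap.id_apply]
  have hratio : s⁻¹ * r ∈ Ioo (0 : ℝ) 1 :=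
    ⟨by positivity, by rwa [← div_eq_inv_mul, div_lt_one hs]⟩
  rw [ho.frontier_eq] at hp hq
  exact hq.2 (hshrink ▸ homothety_mem_of_mem_closure ho hc hoΩ hratio hp.1)

lemma pairwiseDisjoint_homothety_image_frontier (ho : IsOpen Ω) (hc : Convex ℝ Ω) (hoΩ : o ∈ Ω) :
    (Ioi (0 : ℝ)).PairwiseDisjoint fun r => AffineMap.homothety o r '' frontier Ω := by
  intro r hr s hs hrs
  rcases lt_or_gt_of_ne hrs with h | h
  · exact disjoint_homothety_image_frontier ho hc hoΩ hr h
  · exact (disjoint_homothety_image_frontier ho hc hoΩ hs h).symm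

end Homothety

lemma crossings_union_le (A B : Set Plane) (m c : ℝ) :
    crossings (setMultiplicity (A ∪ B)) m c ≤
      crossings (setMultiplicity A) m c + crossings (setMultiplicity B) m c := by
  simp only [crossings_setMultiplicity, union_inter_distrib_right]
  exact_mod_cast encard_union_le _ _

lemma crossings_biUnion_le {ι : Type*} (F : Finset ι) (A : ι → Set Plane) (m c : ℝ) :
    crossings (setMultiplicity (⋃ i ∈ F, A i)) m c ≤
      ∑ i ∈ F, crossings (setMultiplicity (A i)) m c := by
  classical
  induction F using Finset.induction_on with
  | empty => simp [crossings_setMultiplicity]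
  | insert i F hi ih =>
    rw [Finset.set_biUnion_insert, Finset.sum_insert hi]
    exact (crossings_union_le _ _ m c).trans (by gcongr)

lemma measure_union_of_measure_inter_eq_zero {X : Type*} [MeasurableSpace X] {μ : Measure X}
    {A B : Set X} (hB : MeasurableSet B) (h : μ (A ∩ B) = 0) : μ (A ∪ B) = μ A + μ B := by
  rw [← measure_union_add_inter A hB, h, add_zero]

/-- The union of the images of `∂Ω` under the homotheties with centre `o` and factors in `F`. It
replaces a multiple of `∂Ω` by a set without multiplicity. -/
def homotheticBoundaries (Ω : Set Plane) (o : Plane) (F : Finset ℝ) : Set Plane :=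
  ⋃ r ∈ F, AffineMap.homothety o r '' frontier Ω

lemma measurableSet_homothety_image_frontier (Ω : Set Plane) (o : Plane) {r : ℝ} (hr : r ≠ 0) :
    MeasurableSet (AffineMap.homothety o r '' frontier Ω) := by
  rw [← frontier_homothety_image Ω o hr]
  exact isClosed_frontier.measurableSet

lemma measurableSet_homotheticBoundaries (Ω : Set Plane) (o : Plane) {F : Finset ℝ}
    (hF : ∀ r ∈ F, r ≠ 0) :
    MeasurableSet (homotheticBoundaries Ω o F) :=
  F.measurableSet_biUnion fun r hr => measurableSet_homothety_image_frontier Ω o (hF r hr)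

namespace IsConvexDomain

variable {Ω : Set Plane} {o : Plane} {F : Finset ℝ}

lemma homothety_image (hΩ : IsConvexDomain Ω) (o : Plane) {r : ℝ} (hr : r ≠ 0) :
    IsConvexDomain (AffineMap.homothety o r '' Ω) where
  nonempty := hΩ.nonempty.image _
  isOpen := AffineMap.homothety_isOpenMap o r hr _ hΩ.isOpen
  isBounded := by
    refine (hΩ.isBounded.isCompact_closure.image
      (AffineMap.homothety_continuous o r)).isBounded.subset (image_mono subset_closure)
  convex := hΩ.convex.affine_image _

lemma ae_crossings_homothety_image_frontier_le (hΩ : IsConvexDomain Ω) (ho : o ∈ Ω) {r : ℝ}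
    (hr : r ∈ Ioo (0 : ℝ) 1) (m : ℝ) :
    ∀ᵐ c, crossings (setMultiplicity (AffineMap.homothety o r '' frontier Ω)) m c ≤
      crossings (setMultiplicity (frontier Ω)) m c := by
  have hcopy := hΩ.homothety_image o hr.1.ne'
  have hsub : AffineMap.homothety o r '' Ω ⊆ Ω := (image_mono subset_closure).trans
    (homothety_image_closure_subset hΩ.isOpen hΩ.convex ho hr)
  rw [← frontier_homothety_image Ω o hr.1.ne']
  filter_upwards [ae_crossings_frontier hcopy.isOpen hcopy.convex hcopy.isBounded m,
    ae_crossings_frontier hΩ.isOpen hΩ.convex hΩ.isBounded m] with c hcross hcrossΩ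
  rw [hcross, hcrossΩ]
  split_ifs with hc hcΩ
  · exact le_rfl
  · exact absurd (image_mono hsub hc) hcΩ
  · exact zero_le
  · exact le_rfl

lemma ae_crossings_homotheticBoundaries_le (hΩ : IsConvexDomain Ω) (ho : o ∈ Ω)
    (hF : ∀ r ∈ F, r ∈ Ioo (0 : ℝ) 1) (m : ℝ) :
    ∀ᵐ c, crossings (setMultiplicity (homotheticBoundaries Ω o F)) m c ≤
      F.card * crossings (setMultiplicity (frontier Ω)) m c := by
  filter_upwards [(Filter.eventually_all_finset F).2 fun r hr =>
    hΩ.ae_crossings_homothety_image_frontier_le ho (hF r hr) m] with c hc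
  refine (crossings_biUnion_le F _ m c).trans ((Finset.sum_le_sum hc).trans_eq ?_)
  rw [Finset.sum_const, nsmul_eq_mul]

lemma homotheticBoundaries_subset (hΩ : IsConvexDomain Ω) (ho : o ∈ Ω)
    (hF : ∀ r ∈ F, r ∈ Ioo (0 : ℝ) 1) : homotheticBoundaries Ω o F ⊆ Ω :=
  iUnion₂_subset fun r hr => (image_mono frontier_subset_closure).trans
    (homothety_image_closure_subset hΩ.isOpen hΩ.convex ho (hF r hr))

lemma isRectifiable_homotheticBoundaries (hΩ : IsConvexDomain Ω) (o : Plane)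
    (hF : ∀ r ∈ F, r ≠ 0) : IsRectifiable (homotheticBoundaries Ω o F) := by
  have hunion : homotheticBoundaries Ω o F =
      ⋃ r : F, AffineMap.homothety o (r : ℝ) '' frontier Ω := by
    rw [homotheticBoundaries, iUnion_subtype]
  rw [hunion]
  refine .iUnion fun r => ?_
  rw [← frontier_homothety_image Ω o (hF r r.2)]
  exact (hΩ.homothety_image o (hF r r.2)).isRectifiable_frontier

lemma hausdorffMeasure_homotheticBoundaries (hΩ : IsConvexDomain Ω) (ho : o ∈ Ω)
    (hF : ∀ r ∈ F, 0 < r) :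
    μH[1] (homotheticBoundaries Ω o F) = ENNReal.ofReal ((∑ r ∈ F, r) * perimeter Ω) := by
  have hcopy : ∀ r ∈ F, μH[1] (AffineMap.homothety o r '' frontier Ω) =
      ENNReal.ofReal r * ENNReal.ofReal (perimeter Ω) := fun r hr => by
    rw [hausdorffMeasure_homothety_image zero_le_one o (hF r hr).ne', NNReal.rpow_one,
      hΩ.ofReal_perimeter, ENNReal.smul_def, smul_eq_mul, ← enorm_eq_nnnorm,
      Real.enorm_of_nonneg (hF r hr).le]
  have hdisj := pairwiseDisjoint_homothety_image_frontier hΩ.isOpen hΩ.convex ho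
  rw [homotheticBoundaries, measure_biUnion_finset (hdisj.subset hF)
    fun r hr => measurableSet_homothety_image_frontier Ω o (hF r hr).ne',
    Finset.sum_congr rfl hcopy, ← Finset.sum_mul,
    ← ENNReal.ofReal_sum_of_nonneg fun r hr => (hF r hr).le,
    ← ENNReal.ofReal_mul (Finset.sum_nonneg fun r hr => (hF r hr).le)]

lemma exists_hausdorffMeasure_homotheticBoundaries_inter_eq_zero (hΩ : IsConvexDomain Ω)
    (ho : o ∈ Ω) {B : Set Plane} (hB : μH[1] B ≠ ∞) (n : ℕ) {α β : ℝ} (hα : 0 ≤ α) (hαβ : α < β) :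
    ∃ F : Finset ℝ, F.card = n ∧ (∀ r ∈ F, r ∈ Ioo α β) ∧
      μH[1] (homotheticBoundaries Ω o F ∩ B) = 0 := by
  have hpos : Ioo α β ⊆ Ioi 0 := fun r hr => hα.trans_lt hr.1
  obtain ⟨F, hF, hcard⟩ := (infinite_setOf_measure_inter_eq_zero (not_countable_Ioo hαβ)
    (fun r hr => measurableSet_homothety_image_frontier Ω o (hpos hr).ne')
    ((pairwiseDisjoint_homothety_image_frontier hΩ.isOpen hΩ.convex ho).subset hpos)
    hB).exists_subset_card_eq n
  refine ⟨F, hcard, fun r hr => (hF hr).1, ?_⟩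
  rw [homotheticBoundaries, iUnion₂_inter]
  exact (measure_biUnion_null_iff F.countable_toSet).2 fun r hr => (hF hr).2

end IsConvexDomain

lemma norm_vec_le (x y : ℝ) : ‖(!₂[x, y] : Plane)‖ ≤ |x| + |y| := by
  rw [← sq_le_sq₀ (norm_nonneg _) (by positivity), norm_sq_eq_sq_add_sq, add_sq, sq_abs, sq_abs]
  have : 0 ≤ |x| * |y| := by positivity
  simp only [Matrix.cons_val_zero, Matrix.cons_val_one]
  linarith

/-- The horizontal segment of length `δ` whose left endpoint is at signed height `y` above `o`. -/
def horizontalSegment (o : Plane) (δ y : ℝ) : Set Plane :=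
  segment ℝ (o + !₂[0, y]) (o + !₂[δ, y])

lemma horizontalSegment_subset_ball {o : Plane} {δ y ρ : ℝ} (hδ : 0 ≤ δ) (hδy : δ + |y| < ρ) :
    horizontalSegment o δ y ⊆ Metric.ball o ρ := by
  have hmem : ∀ x ∈ Icc 0 δ, o + !₂[x, y] ∈ Metric.ball o ρ := fun x hx => by
    rw [mem_ball_iff_norm, add_sub_cancel_left]
    refine (norm_vec_le x y).trans_lt (lt_of_le_of_lt ?_ hδy)
    rw [abs_of_nonneg hx.1]
    gcongr
    exact hx.2
  exact (convex_ball o ρ).segment_subset (hmem 0 (left_mem_Icc.2 hδ)) (hmem δ (right_mem_Icc.2 hδ))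

lemma apply_one_of_mem_horizontalSegment {o x : Plane} {δ y : ℝ}
    (hx : x ∈ horizontalSegment o δ y) : x 1 = o 1 + y := by
  obtain ⟨s, t, -, -, hst, rfl⟩ := hx
  simp only [PiLp.add_apply, PiLp.smul_apply, Matrix.cons_val_one, smul_eq_mul,
    ← add_mul, hst, one_mul, Matrix.cons_val_fin_one]

lemma pairwiseDisjoint_horizontalSegment (I : Set ℝ) (o : Plane) (δ : ℝ) :
    I.PairwiseDisjoint (horizontalSegment o δ) := fun _ _ _ _ hyz =>
  Set.disjoint_left.2 fun _ hxy hxz => hyz <| add_left_cancel <|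
    (apply_one_of_mem_horizontalSegment hxy).symm.trans (apply_one_of_mem_horizontalSegment hxz)

lemma measurableSet_horizontalSegment (o : Plane) (δ y : ℝ) :
    MeasurableSet (horizontalSegment o δ y) :=
  (isClosed_segment _ _).measurableSet

lemma hausdorffMeasure_horizontalSegment (o : Plane) {δ : ℝ} (hδ : 0 ≤ δ) (y : ℝ) :
    μH[1] (horizontalSegment o δ y) = ENNReal.ofReal δ := by
  rw [horizontalSegment, hausdorffMeasure_segment, edist_dist, dist_add_left, dist_eq_norm]
  congr 1
  rw [← sq_eq_sq₀ (norm_nonneg _) hδ, norm_sq_eq_sq_add_sq]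
  simp

lemma exists_horizontalSegment_inter_eq_zero {o : Plane} {ρ δ : ℝ} (hδ : 0 ≤ δ) (hδρ : δ < ρ)
    {B : Set Plane} (hB : μH[1] B ≠ ∞) :
    ∃ y, horizontalSegment o δ y ⊆ Metric.ball o ρ ∧
      μH[1] (horizontalSegment o δ y ∩ B) = 0 := by
  obtain ⟨y, hy, hnull⟩ := (infinite_setOf_measure_inter_eq_zero
    (not_countable_Ioo (sub_pos.2 hδρ)) (fun y _ => measurableSet_horizontalSegment o δ y)
    (pairwiseDisjoint_horizontalSegment _ o δ) hB).nonempty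
  refine ⟨y, horizontalSegment_subset_ball hδ ?_, hnull⟩
  rw [abs_of_pos hy.1]
  linarith [hy.2]

lemma sq_le_sq_add_mul {M x y s : ℝ≥0∞} (hs : s ≤ 1) (hx : x ≤ M) (hy : y ≤ x + s) :
    y ^ 2 ≤ x ^ 2 + (2 * M + 1) * s :=
  calc y ^ 2 ≤ (x + s) ^ 2 := by gcongr
    _ = x ^ 2 + (2 * x + s) * s := by ring
    _ ≤ x ^ 2 + (2 * M + 1) * s := by gcongr

theorem energy_le_of_crossings_sq_le {Ω A S : Set Plane} {L : ℝ} {θ : Plane → ℕ} {k : ℝ≥0∞}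
    (hk : k ≠ ∞) (hA : IsRectifiableSetIn Ω L A) (hθ : IsRectifiableMultisetIn Ω L θ)
    (hS : NullMeasurableSet S μH[1]) (hSr : IsRectifiable S)
    (h : ∀ᵐ m, ∀ᵐ c, crossings (setMultiplicity A) m c ^ 2 ≤
      crossings θ m c ^ 2 + k * crossings (setMultiplicity S) m c) :
    energy A ≤ multisetEnergy θ + k * (2 * μH[1] S) := by
  have hle := lineIntegral_mono h
  rw [lineIntegral_crossings_sq (aemeasurable_setMultiplicity hA.measurable)
    (by rw [support_setMultiplicity]; exact hA.rectifiable),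
    arclength_setMultiplicity_univ hA.measurable, hA.length_eq,
    multisetEnergy_setMultiplicity hA.measurable,
    lineIntegral_crossings_sq_add_mul hk hθ.measurable hθ.rectifiable hS hSr, hθ.length_eq,
    add_right_comm] at hle
  exact (ENNReal.add_le_add_iff_right (by finiteness)).1 hle

lemma IsRectifiableSetIn.isRectifiableMultisetIn {Ω A : Set Plane} {L : ℝ}
    (hA : IsRectifiableSetIn Ω L A) : IsRectifiableMultisetIn Ω L (setMultiplicity A) where
  subset := (support_setMultiplicity A).symm ▸ hA.subset
  measurable := aemeasurable_setMultiplicity hA.measurable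
  rectifiable := (support_setMultiplicity A).symm ▸ hA.rectifiable
  length_eq := (arclength_setMultiplicity_univ hA.measurable).trans hA.length_eq

lemma card_sub_sum_mem_Icc {F : Finset ℝ} {ε : ℝ} (hF : ∀ r ∈ F, r ∈ Ioo (1 - ε) 1) :
    F.card - ∑ r ∈ F, r ∈ Icc 0 (F.card * ε) := by
  have hsum : (F.card : ℝ) - ∑ r ∈ F, r = ∑ r ∈ F, (1 - r) := by
    rw [Finset.sum_sub_distrib, Finset.sum_const, nsmul_one]
  rw [hsum]
  refine ⟨Finset.sum_nonneg fun r hr => by linarith [(hF r hr).2], ?_⟩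
  rw [← nsmul_eq_mul]
  exact Finset.sum_le_card_nsmul F _ ε fun r hr => by linarith [(hF r hr).1]

namespace IsConvexDomain

variable {Ω : Set Plane} {o a b : Plane} {L : ℝ} {n : ℕ}

lemma exists_segment_of_le_diam (hΩ : IsConvexDomain Ω) {d : ℝ} (hd : 0 ≤ d)
    (hdiam : d ≤ Metric.diam Ω) :
    ∃ a b : Plane, segment ℝ a b ⊆ closure Ω ∧ dist a b = d := by
  have hK : IsCompact (closure Ω) := hΩ.isBounded.isCompact_closure
  obtain ⟨⟨p, q⟩, ⟨hp, hq⟩, hmax⟩ := (hK.prod hK).exists_isMaxOn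
    (hΩ.nonempty.closure.prod hΩ.nonempty.closure)
    (f := fun x : Plane × Plane => dist x.1 x.2) continuous_dist.continuousOn
  have hpq : d ≤ dist p q := hdiam.trans <| Metric.diam_le_of_forall_dist_le dist_nonneg
    fun x hx y hy => isMaxOn_iff.1 hmax (x, y) ⟨subset_closure hx, subset_closure hy⟩
  have hcont : Continuous fun t : ℝ => dist p (AffineMap.lineMap p q t) :=
    continuous_const.dist AffineMap.lineMap_continuous
  obtain ⟨t, ht, htd⟩ := intermediate_value_Icc zero_le_one hcont.continuousOn
    (show d ∈ Icc _ _ by simpa using ⟨hd, hpq⟩)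
  refine ⟨p, _, hΩ.convex.closure.segment_subset hp ?_, htd⟩
  exact hΩ.convex.closure.lineMap_mem hp hq ht

lemma exists_homotheticBoundaries (hΩ : IsConvexDomain Ω) (ho : o ∈ Ω) (n : ℕ) (a b : Plane)
    {η : ℝ} (hη : 0 < η) :
    ∃ F : Finset ℝ, F.card = n ∧ (∀ r ∈ F, r ∈ Ioo (0 : ℝ) 1) ∧
      μH[1] (homotheticBoundaries Ω o F ∩ segment ℝ a b) = 0 ∧
      (n - ∑ r ∈ F, r) * perimeter Ω ∈ Icc 0 η := by
  have hP : 0 ≤ perimeter Ω := ENNReal.toReal_nonneg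
  set ε := min 1 (η / (n * perimeter Ω + 1))
  have hε : 0 < ε := by positivity
  have hε1 : ε ≤ 1 := min_le_left _ _
  obtain ⟨F, hcard, hF, hnull⟩ := hΩ.exists_hausdorffMeasure_homotheticBoundaries_inter_eq_zero ho
    (B := segment ℝ a b) (by rw [hausdorffMeasure_segment]; exact edist_ne_top a b) n
    (sub_nonneg.2 hε1) (sub_lt_self 1 hε)
  have hgap := card_sub_sum_mem_Icc hF
  rw [hcard] at hgap
  refine ⟨F, hcard, fun r hr => Ioo_subset_Ioo_left (sub_nonneg.2 hε1) (hF r hr), hnull,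
    mul_nonneg hgap.1 hP, ?_⟩
  calc (n - ∑ r ∈ F, r) * perimeter Ω ≤ n * ε * perimeter Ω := by gcongr; exact hgap.2
    _ = ε * (n * perimeter Ω) := by ring
    _ ≤ η / (n * perimeter Ω + 1) * (n * perimeter Ω + 1) := by
      gcongr
      · exact min_le_right _ _
      · linarith
    _ = η := div_mul_cancel₀ _ (by positivity)

end IsConvexDomain

/-- The competitor without multiplicity: homothetic copies of `∂Ω`, the segment `[a, b]`, and a
short horizontal segment that makes up for the length lost in shrinking `∂Ω`. -/
def approximatingSet (Ω : Set Plane) (o : Plane) (F : Finset ℝ) (a b : Plane) (δ y : ℝ) :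
    Set Plane :=
  homotheticBoundaries Ω o F ∪ segment ℝ a b ∪ horizontalSegment o δ y

namespace IsConvexDomain

variable {Ω : Set Plane} {o a b : Plane} {F : Finset ℝ} {L δ : ℝ} {n : ℕ}

lemma hausdorffMeasure_homotheticBoundaries_union_segment (hΩ : IsConvexDomain Ω) (ho : o ∈ Ω)
    (hF : ∀ r ∈ F, 0 < r) (hnull : μH[1] (homotheticBoundaries Ω o F ∩ segment ℝ a b) = 0) :
    μH[1] (homotheticBoundaries Ω o F ∪ segment ℝ a b) =
      ENNReal.ofReal ((∑ r ∈ F, r) * perimeter Ω + dist a b) := by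
  have hP : 0 ≤ perimeter Ω := ENNReal.toReal_nonneg
  have hsum : 0 ≤ ∑ r ∈ F, r := Finset.sum_nonneg fun r hr => (hF r hr).le
  rw [measure_union_of_measure_inter_eq_zero (isClosed_segment a b).measurableSet hnull,
    hΩ.hausdorffMeasure_homotheticBoundaries ho hF, hausdorffMeasure_segment, edist_dist,
    ENNReal.ofReal_add (by positivity) dist_nonneg]

lemma isRectifiableSetIn_approximatingSet (hΩ : IsConvexDomain Ω) (ho : o ∈ Ω)
    (hab : segment ℝ a b ⊆ closure Ω) (hF : ∀ r ∈ F, r ∈ Ioo (0 : ℝ) 1) (hδ : 0 ≤ δ) {y : ℝ}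
    (hy : horizontalSegment o δ y ⊆ Ω)
    (hnull : μH[1] (homotheticBoundaries Ω o F ∩ segment ℝ a b) = 0)
    (hynull : μH[1] (horizontalSegment o δ y ∩
      (homotheticBoundaries Ω o F ∪ segment ℝ a b)) = 0) :
    IsRectifiableSetIn Ω ((∑ r ∈ F, r) * perimeter Ω + dist a b + δ)
      (approximatingSet Ω o F a b δ y) where
  subset := union_subset (union_subset ((hΩ.homotheticBoundaries_subset ho hF).trans
    subset_closure) hab) (hy.trans subset_closure)
  measurable := (((measurableSet_homotheticBoundaries Ω o fun r hr => (hF r hr).1.ne').union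
    (isClosed_segment a b).measurableSet).union
    (measurableSet_horizontalSegment o δ y)).nullMeasurableSet
  rectifiable := ((hΩ.isRectifiable_homotheticBoundaries o fun r hr => (hF r hr).1.ne').union
    (isRectifiable_segment a b)).union (isRectifiable_segment _ _)
  length_eq := by
    have hP : 0 ≤ perimeter Ω := ENNReal.toReal_nonneg
    have hsum : 0 ≤ ∑ r ∈ F, r := Finset.sum_nonneg fun r hr => (hF r hr).1.le
    rw [approximatingSet, measure_union_of_measure_inter_eq_zero
      (measurableSet_horizontalSegment o δ y) (by rwa [inter_comm]),
      hΩ.hausdorffMeasure_homotheticBoundaries_union_segment ho (fun r hr => (hF r hr).1) hnull,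
      hausdorffMeasure_horizontalSegment o hδ, ENNReal.ofReal_add (by positivity) hδ]

lemma ae_crossings_approximatingSet_le (hΩ : IsConvexDomain Ω) (ho : o ∈ Ω)
    (hF : ∀ r ∈ F, r ∈ Ioo (0 : ℝ) 1) (a b : Plane) (δ y m : ℝ) :
    ∀ᵐ c, crossings (setMultiplicity (approximatingSet Ω o F a b δ y)) m c ≤
      crossings (boundaryCopiesAndSegment Ω F.card a b) m c +
        crossings (setMultiplicity (horizontalSegment o δ y)) m c := by
  filter_upwards [hΩ.ae_crossings_homotheticBoundaries_le ho hF m] with c hc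
  rw [crossings_boundaryCopiesAndSegment]
  refine (crossings_union_le _ _ m c).trans ?_
  gcongr
  refine (crossings_union_le _ _ m c).trans ?_
  gcongr

lemma ae_crossings_boundaryCopiesAndSegment_le (hΩ : IsConvexDomain Ω)
    (hab : segment ℝ a b ⊆ closure Ω) (n : ℕ) :
    ∀ᵐ m, ∀ᵐ c, crossings (boundaryCopiesAndSegment Ω n a b) m c ≤ 2 * n + 1 := by
  filter_upwards [hΩ.ae_crossings_boundaryCopiesAndSegment hab n] with m hm
  filter_upwards [hm] with c hc
  rcases hc with ⟨-, h | h⟩ | ⟨-, h⟩ <;> rw [h]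
  · exact le_self_add
  · exact zero_le

theorem energy_approximatingSet_le (hΩ : IsConvexDomain Ω) (ho : o ∈ Ω)
    (hab : segment ℝ a b ⊆ closure Ω) (hF : ∀ r ∈ F, r ∈ Ioo (0 : ℝ) 1) (hδ : 0 ≤ δ) {y : ℝ}
    (hL : dist a b = L - F.card * perimeter Ω)
    (hA : IsRectifiableSetIn Ω L (approximatingSet Ω o F a b δ y)) :
    energy (approximatingSet Ω o F a b δ y) ≤
      multisetEnergy (boundaryCopiesAndSegment Ω F.card a b) +
        (2 * (2 * F.card + 1) + 1) * (2 * ENNReal.ofReal δ) := by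
  rw [← hausdorffMeasure_horizontalSegment o hδ y]
  refine energy_le_of_crossings_sq_le (by finiteness) hA
    (hΩ.isRectifiableMultisetIn_boundaryCopiesAndSegment hab hL)
    (measurableSet_horizontalSegment o δ y).nullMeasurableSet (isRectifiable_segment _ _) ?_
  filter_upwards [hΩ.ae_crossings_boundaryCopiesAndSegment_le hab F.card,
    _root_.ae_crossings_segment (o + !₂[0, y]) (o + !₂[δ, y])] with m hm hsegment
  filter_upwards [hm, hΩ.ae_crossings_approximatingSet_le ho hF a b δ y m] with c hbound hcross
  exact sq_le_sq_add_mul (hsegment c) hbound hcross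

theorem exists_isRectifiableSetIn_energy_le (hΩ : IsConvexDomain Ω)
    (hab : segment ℝ a b ⊆ closure Ω) (hL : dist a b = L - n * perimeter Ω) {η : ℝ}
    (hη : 0 < η) :
    ∃ A, IsRectifiableSetIn Ω L A ∧ energy A ≤
      multisetEnergy (boundaryCopiesAndSegment Ω n a b) +
        (2 * (2 * n + 1) + 1) * (2 * ENNReal.ofReal η) := by
  obtain ⟨o, ho⟩ := hΩ.nonempty
  obtain ⟨ρ, hρ, hball⟩ := Metric.isOpen_iff.1 hΩ.isOpen o ho
  obtain ⟨F, rfl, hF, hnull, hδ⟩ := hΩ.exists_homotheticBoundaries ho n a b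
    (η := min η (ρ / 2)) (by positivity)
  set δ := (F.card - ∑ r ∈ F, r) * perimeter Ω
  have hδη : δ ≤ η := hδ.2.trans (min_le_left _ _)
  have hδρ : δ < ρ := (hδ.2.trans (min_le_right _ _)).trans_lt (half_lt_self hρ)
  obtain ⟨y, hy, hynull⟩ := exists_horizontalSegment_inter_eq_zero (o := o) hδ.1 hδρ
    (B := homotheticBoundaries Ω o F ∪ segment ℝ a b) (by
      rw [hΩ.hausdorffMeasure_homotheticBoundaries_union_segment ho (fun r hr => (hF r hr).1) hnull]
      exact ENNReal.ofReal_ne_top)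
  have hlength : (∑ r ∈ F, r) * perimeter Ω + dist a b + δ = L := by
    rw [hL]
    ring
  have hA := hΩ.isRectifiableSetIn_approximatingSet ho hab hF hδ.1 (hy.trans hball) hnull hynull
  rw [hlength] at hA
  refine ⟨_, hA, (hΩ.energy_approximatingSet_le ho hab hF hδ.1 hL hA).trans ?_⟩
  gcongr

theorem isGLB_energy (hΩ : IsConvexDomain Ω) (hab : segment ℝ a b ⊆ closure Ω)
    (hL : dist a b = L - n * perimeter Ω) :
    IsGLB {e : ℝ≥0∞ | ∃ A : Set Plane, IsRectifiableSetIn Ω L A ∧ e = energy A}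
      (multisetEnergy (boundaryCopiesAndSegment Ω n a b)) := by
  refine ⟨?_, fun e he => ENNReal.le_of_forall_pos_le_add fun ε hε _ => ?_⟩
  · rintro _ ⟨A, hA, rfl⟩
    rw [← multisetEnergy_setMultiplicity hA.measurable]
    exact hΩ.multisetEnergy_boundaryCopiesAndSegment_le hab hL hA.isRectifiableMultisetIn
  · set η : ℝ≥0 := ε / ((2 * (2 * n + 1) + 1) * 2)
    have hη : (2 * (2 * n + 1) + 1) * (2 * η) = ε := by
      rw [← mul_assoc]
      exact mul_div_cancel₀ _ (by positivity)
    obtain ⟨A, hA, hle⟩ := hΩ.exists_isRectifiableSetIn_energy_le hab hL (η := η) (by positivity)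
    rw [ENNReal.ofReal_coe_nnreal] at hle
    exact (he ⟨A, hA, rfl⟩).trans (hle.trans_eq (by rw [← hη]; push_cast; rfl))

end IsConvexDomain

end

theorem theorem1_general (Ω : Set Plane) (hne : Ω.Nonempty) (hopen : IsOpen Ω)
    (hbdd : Bornology.IsBounded Ω) (hconv : Convex ℝ Ω)
    (n : ℕ) (L : ℝ) (hL₀ : 0 ≤ L - n * perimeter Ω)
    (hL₁ : L - n * perimeter Ω ≤ Metric.diam Ω) :
    (∃ a b : Plane, segment ℝ a b ⊆ closure Ω ∧ dist a b = L - n * perimeter Ω) ∧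
    ∀ a b : Plane, segment ℝ a b ⊆ closure Ω → dist a b = L - n * perimeter Ω →
      IsRectifiableMultisetIn Ω L (boundaryCopiesAndSegment Ω n a b) ∧
      (∀ θ : Plane → ℕ, IsRectifiableMultisetIn Ω L θ →
        multisetEnergy (boundaryCopiesAndSegment Ω n a b) ≤ multisetEnergy θ) ∧
      IsGLB {e : ℝ≥0∞ | ∃ A : Set Plane, IsRectifiableSetIn Ω L A ∧ e = energy A}
        (multisetEnergy (boundaryCopiesAndSegment Ω n a b)) := by
  have hΩ : IsConvexDomain Ω := ⟨hne, hopen, hbdd, hconv⟩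
  refine ⟨hΩ.exists_segment_of_le_diam hL₀ hL₁, fun a b hab hL => ⟨?_, fun θ hθ => ?_, ?_⟩⟩
  · exact hΩ.isRectifiableMultisetIn_boundaryCopiesAndSegment hab hL
  · exact hΩ.multisetEnergy_boundaryCopiesAndSegment_le hab hL hθ
  · exact hΩ.isGLB_energy hab hL

theorem theorem1 (Ω : Set Plane) (hne : Ω.Nonempty) (hopen : IsOpen Ω)
    (hbdd : Bornology.IsBounded Ω) (hconv : Convex ℝ Ω) (hC1 : HasC1Boundary Ω)
    (n : ℕ) (L : ℝ) (hL₀ : 0 ≤ L - n * perimeter Ω)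
    (hL₁ : L - n * perimeter Ω ≤ Metric.diam Ω) :
    (∃ a b : Plane, segment ℝ a b ⊆ closure Ω ∧ dist a b = L - n * perimeter Ω) ∧
    ∀ a b : Plane, segment ℝ a b ⊆ closure Ω → dist a b = L - n * perimeter Ω →
      IsRectifiableMultisetIn Ω L (boundaryCopiesAndSegment Ω n a b) ∧
      (∀ θ : Plane → ℕ, IsRectifiableMultisetIn Ω L θ →
        multisetEnergy (boundaryCopiesAndSegment Ω n a b) ≤ multisetEnergy θ) ∧
      IsGLB {e : ℝ≥0∞ | ∃ A : Set Plane, IsRectifiableSetIn Ω L A ∧ e = energy A}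
        (multisetEnergy (boundaryCopiesAndSegment Ω n a b)) :=
  theorem1_general Ω hne hopen hbdd hconv n L hL₀ hL₁
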